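/- Let $k$ be a field, $A$ a finite dimensional Frobenius $k$-algebra, $A^{\mathrm e}=A\otimes_k A^{\mathrm{op}}$; regard $A$-bimodules (on which $k$ acts centrally) as left $A^{\mathrm e}$-modules by $(a\otimes b)x=axb$, and as right $A^{\mathrm e}$-modules by $x(a\otimes b)=bxa$. A complete resolution of a bimodule $M$ is an exact complex $T$ of finitely generated projective bimodules $T_i$ $(i\in\mathbb Z)$ such that $\operatorname{Hom}_{A^{\mathrm e}}(T,A^{\mathrm e})$ is exact, together with a surjection $\varepsilon:T_0\to M$ with kernel $\operatorname{Im} d_1$. Put $\Omega^iM=\operatorname{Ker}(d_{i-1}:T_{i-1}\to T_{i-2})$ and let $\pi_i:T_i\to\Omega^iM$ be the epimorphism induced by $d_i$. Let $T$ be a complete resolution of $A$, let $\Omega^iA$ be formed with $T$, and let $\Delta:T\to T\hat\otimes_AT$ be a diagonal approximation, i.e. a chain map of complexes of bimodules into the complete tensor product $(T\hat\otimes_AT)_n=\prod_{p+q=n}T_p\otimes_AT_q$ (with differential $d\otimes 1+(-1)^p\,1\otimes d$ on $T_p\otimes_A T_q$) such that $(\varepsilon\hat\otimes\varepsilon)\Delta=\varepsilon$,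 where $A\otimes_AA=A$. Put $\widehat H^n(A,A)=H^n(\operatorname{Hom}_{A^{\mathrm e}}(T,A))$ and $\widehat H_n(A,M)=H_n(T\otimes_{A^{\mathrm e}}M)$. The products $$\smile:\widehat H^i(A,A)\otimes\widehat H^j(A,A)\to\widehat H^{i+j}(A,A),\qquad \frown:\widehat H^i(A,A)\otimes\widehat H_j(A,M)\to\widehat H_{j-i}(A,M)$$ are induced by $u\smile v=(u\hat\otimes v)\Delta$, where $u\hat\otimes v$ is $x\otimes y\mapsto(-1)^{ij}u(x)v(y)$ on $T_i\otimes_AT_j$ and zero on the other components, and by $u\frown(a\otimes m)=\sum(-1)^{i(j-i)}x\otimes u(y)m$, where $\sum x\otimes y$ is the component of $\Delta(a)$ in $T_{j-i}\otimes_AT_i$. For bimodules $X,Y$ let $\underline{\operatorname{Hom}}(X,Y)$ be $\operatorname{Hom}_{A^{\mathrm e}}(X,Y)$ modulo the maps that factor through a projective bimodule, and let $X\,\underline\otimes\,Y$ be the space of all $w\in X\otimes_{A^{\mathrm e}}Y$ with $(\mathrm{id}\otimes\iota)(w)=0$ for all monomorphisms $\iota$ from $Y$ to injective bimodules. Eu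 and Schedler's products on these are as follows. * $\cup:\underline{\operatorname{Hom}}(\Omega^iA,A)\otimes\underline{\operatorname{Hom}}(\Omega^jA,A)\to\underline{\operatorname{Hom}}(\Omega^{i+j}A,A)$ is $[f]\cup[g]=[f\circ\Omega^i(g)]$. Here $\Omega^i(g):\Omega^{i+j}A\to\Omega^iA$ is the map with $\Omega^i(g)\pi_{i+j}=\pi_ig_i$ for a lift of $g$ to a chain map $(g_q:T_{q+j}\to T_q)_{q\in\mathbb Z}$ from $\Sigma^{-j}T$ to $T$, $\varepsilon g_0=g\pi_j$, where $\Sigma^{-j}T$ ($q$-th term $T_{q+j}$, differential $(-1)^jd$, augmentation $\pi_j$) is regarded as a complete resolution of $\Omega^jA$, with the epimorphisms $\pi_{q+j}:T_{q+j}\to\Omega^{q+j}A=\Omega^q\Omega^jA$. * For a finitely generated bimodule $M$, $\cap:\underline{\operatorname{Hom}}(\Omega^iA,A)\otimes(\Omega^jA\,\underline\otimes\,M)\to\Omega^{j-i}A\,\underline\otimes\,M$ is, for $f:\Omega^iA\to A$, the composite $$\Omega^jA\,\underline\otimes\,M\cong\Omega^iA\,\underline\otimes\,\Omega^{j-i}M\xrightarrow{f\otimes\mathrm{id}}A\,\underline\otimes\,\Omega^{j-i}M\cong\Omega^{j-i}A\,\underline\otimes\,M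 .$$ The isomorphisms are the instances $L=\Omega^iA$ (with the complete resolution $\Sigma^{-i}T$ and the epimorphisms $\pi_{q+i}:T_{q+i}\to\Omega^{q+i}A$, as above) and $L=A$ (with $T$) of the isomorphism $\Omega^nL\,\underline\otimes\,M\cong L\,\underline\otimes\,\Omega^nM$ defined, for complete resolutions $P$ of $L$ and $S$ of $M$, as follows: $w\in\Omega^nL\,\underline\otimes\,M$ corresponds to $y\in L\,\underline\otimes\,\Omega^nM$ if there are $t_{p,q}\in P_p\otimes_{A^{\mathrm e}}S_q$ for $p+q=n$ with $(d\otimes1)t_{p+1,q}=(1\otimes d)t_{p,q+1}$ whenever $p+q+1=n$, with $w=(\pi_n\otimes\varepsilon)t_{n,0}$ and $y=(\varepsilon\otimes\pi_n)t_{0,n}$. Then the following hold. 1. $\cup$ is well defined and bilinear. The graded vector spaces $\bigoplus_i\widehat H^i(A,A)$ with $\smile$ (unit $[\varepsilon]$) and $\bigoplus_i\underline{\operatorname{Hom}}(\Omega^iA,A)$ with $\cup$ are associative unital graded commutative algebras ($xy=(-1)^{|x||y|}yx$), and the maps $\Phi_i:\underline{\operatorname{Hom}}(\Omega^iA,A)\to\widehat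 H^i(A,A)$, $[f]\mapsto[f\pi_i]$ $(i\in\mathbb Z)$ form an isomorphism between them: they are well defined linear isomorphisms, $\Phi_{i+j}(f\cup g)=\Phi_i(f)\smile\Phi_j(g)$, and units correspond. 2. For every finitely generated bimodule $M$, $\cap$ is well defined, bilinear and independent of the complete resolution $S$ of $M$. There are linear isomorphisms $\Psi_j:\Omega^jA\,\underline\otimes\,M\to\widehat H_j(A,M)$ $(j\in\mathbb Z)$, sending $w$ to $[z]$ for any cycle $z$ with $(\pi_j\otimes\mathrm{id})(z)=w$, and for all $i,j\in\mathbb Z$ $$\Psi_{j-i}(f\cap z)=\Phi_i(f)\frown\Psi_j(z)\qquad\bigl(f\in\underline{\operatorname{Hom}}(\Omega^iA,A),\ z\in\Omega^jA\,\underline\otimes\,M\bigr).$$ -/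

import Mathlib

set_option linter.unusedSectionVars false

open scoped TensorProduct ModuleCat
open MulOpposite

universe u

namespace TateHochschild

noncomputable section

/-! ## Frobenius algebras and bimodules -/

/-- A (finite dimensional) `k`-algebra is Frobenius if it carries a non-degenerate bilinear form
with `⟨ab, c⟩ = ⟨a, bc⟩`. -/
def IsFrobenius (k A : Type u) [Field k] [Ring A] [Algebra k A] : Prop :=
  ∃ B : LinearMap.BilinForm k A, B.Nondegenerate ∧ ∀ a b c : A, B (a * b) c = B a (b * c)

/-- The enveloping algebra `A ⊗ A°`. A bimodule `M` is a left module over it, with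
`(a ⊗ b°) m = a m b`; thus `a m = (a ⊗ 1) • m` and `m b = (1 ⊗ b°) • m`. -/
def Env (k A : Type u) [Field k] [Ring A] [Algebra k A] : Type u := A ⊗[k] Aᵐᵒᵖ

section Env

variable (k A : Type u) [Field k] [Ring A] [Algebra k A]

instance : Ring (Env k A) := inferInstanceAs (Ring (A ⊗[k] Aᵐᵒᵖ))
instance : Algebra k (Env k A) := inferInstanceAs (Algebra k (A ⊗[k] Aᵐᵒᵖ))

variable {A}

/-- The pure tensor `a ⊗ b°`. -/
def Env.of (a b : A) : Env k A := a ⊗ₜ[k] op b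

variable {k}

theorem Env.of_mul (a b a' b' : A) :
    Env.of k a b * Env.of k a' b' = Env.of k (a * a') (b' * b) :=
  Algebra.TensorProduct.tmul_mul_tmul a a' (op b) (op b')

theorem Env.of_one : Env.of k (1 : A) 1 = 1 := rfl

theorem Env.add_of (a a' b : A) : Env.of k (a + a') b = Env.of k a b + Env.of k a' b :=
  TensorProduct.add_tmul a a' (op b)

theorem Env.of_add (a b b' : A) : Env.of k a (b + b') = Env.of k a b + Env.of k a b' :=
  TensorProduct.tmul_add a (op b) (op b')

theorem Env.smul_of (c : k) (a b : A) : Env.of k (c • a) b = c • Env.of k a b :=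
  TensorProduct.smul_tmul' c a (op b)

theorem Env.of_smul (c : k) (a b : A) : Env.of k a (c • b) = c • Env.of k a b :=
  TensorProduct.tmul_smul c a (op b)

theorem Env.induction {p : Env k A → Prop} (e : Env k A) (h0 : p 0)
    (h1 : ∀ a b, p (Env.of k a b)) (h2 : ∀ x y, p x → p y → p (x + y)) : p e :=
  TensorProduct.induction_on (motive := p) e h0 (fun a b => h1 a b.unop) h2

end Env

section Regular

variable (k A : Type u) [Field k] [Ring A] [Algebra k A]

/-- `A` as a bimodule over itself. -/
instance regularModule : Module (Env k A) A := 
  (TensorProduct.Algebra.module : Module (A ⊗[k] Aᵐᵒᵖ) A)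

theorem env_smul_def (a b x : A) : Env.of k a b • x = a * x * b := by
  change TensorProduct.Algebra.moduleAux (a ⊗ₜ[k] op b) x = _
  simp [TensorProduct.Algebra.moduleAux, mul_assoc]

instance regularTower : IsScalarTower k (Env k A) A where
  smul_assoc r e x := by
    induction e using Env.induction with
    | h0 => simp
    | h1 a b => rw [← Env.smul_of, env_smul_def, env_smul_def]; simp
    | h2 e e' he he' => simp only [smul_add, add_smul, he, he']

end Regular

variable {k A : Type u} [Field k] [Ring A] [Algebra k A]

/-- Precomposition with `f`, i.e. `Hom(f, N)`. -/
def pre {X Y : Type u} [AddCommGroup X] [Module (Env k A) X] [AddCommGroup Y] [Module (Env k A) Y]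
    (f : X →ₗ[Env k A] Y) (N : Type u) [AddCommGroup N] [Module k N] [Module (Env k A) N]
    [IsScalarTower k (Env k A) N] : (Y →ₗ[Env k A] N) →ₗ[k] (X →ₗ[Env k A] N) where
  toFun g := g ∘ₗ f
  map_add' _ _ := rfl
  map_smul' _ _ := rfl

/-! ## Tensor products over `A` and over the enveloping algebra -/

section Tensor

variable (k A)
variable (X Y : Type u)
  [AddCommGroup X] [Module k X] [Module (Env k A) X] [IsScalarTower k (Env k A) X]
  [AddCommGroup Y] [Module k Y] [Module (Env k A) Y] [IsScalarTower k (Env k A) Y]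

/-- The relations `x a ⊗ y = x ⊗ a y`. -/
def relA : Submodule k (X ⊗[k] Y) :=
  Submodule.span k {t | ∃ (a : A) (x : X) (y : Y),
    t = (Env.of k 1 a • x) ⊗ₜ[k] y
      - x ⊗ₜ[k] (Env.of k a 1 • y)}

/-- The tensor product `X ⊗_A Y` of bimodules. -/
def TensorA : Type u := (X ⊗[k] Y) ⧸ relA k A X Y

instance : AddCommGroup (TensorA k A X Y) := inferInstanceAs (AddCommGroup (_ ⧸ relA k A X Y))
instance : Module k (TensorA k A X Y) := inferInstanceAs (Module k (_ ⧸ relA k A X Y))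

/-- The relations `x (a ⊗ b°) ⊗ y = x ⊗ (a ⊗ b°) y`, where the bimodule `X` is a right module
over the enveloping algebra by `x (a ⊗ b°) = b x a`. -/
def relE : Submodule k (X ⊗[k] Y) :=
  Submodule.span k {t | ∃ (a b : A) (x : X) (y : Y),
    t = (Env.of k b a • x) ⊗ₜ[k] y
      - x ⊗ₜ[k] (Env.of k a b • y)}

/-- The tensor product `X ⊗_{Aᵉ} Y` of bimodules over the enveloping algebra. -/
def TensorE : Type u := (X ⊗[k] Y) ⧸ relE k A X Y

instance : AddCommGroup (TensorE k A X Y) := inferInstanceAs (AddCommGroup (_ ⧸ relE k A X Y))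
instance : Module k (TensorE k A X Y) := inferInstanceAs (Module k (_ ⧸ relE k A X Y))

/-- The projection `X ⊗_k Y → X ⊗_A Y`. -/
def TensorA.proj : X ⊗[k] Y →ₗ[k] TensorA k A X Y := (relA k A X Y).mkQ

/-- The projection `X ⊗_k Y → X ⊗_{Aᵉ} Y`. -/
def TensorE.proj : X ⊗[k] Y →ₗ[k] TensorE k A X Y := (relE k A X Y).mkQ

variable {X Y}

/-- The class of `x ⊗ y` in `X ⊗_A Y`. -/
def TensorA.tmul (x : X) (y : Y) : TensorA k A X Y := TensorA.proj k A X Y (x ⊗ₜ[k] y)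

/-- The class of `x ⊗ y` in `X ⊗_{Aᵉ} Y`. -/
def TensorE.tmul (x : X) (y : Y) : TensorE k A X Y := TensorE.proj k A X Y (x ⊗ₜ[k] y)

variable {k A}

theorem TensorA.induction {p : TensorA k A X Y → Prop} (t : TensorA k A X Y)
    (h0 : p 0) (h1 : ∀ x y, p (TensorA.tmul k A x y)) (h2 : ∀ s t, p s → p t → p (s + t)) :
    p t := by
  obtain ⟨s, rfl⟩ : ∃ s, TensorA.proj k A X Y s = t := (relA k A X Y).mkQ_surjective t
  induction s with
  | zero => rw [map_zero]; exact h0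
  | tmul x y => exact h1 x y
  | add a b ha hb => rw [map_add]; exact h2 _ _ ha hb

theorem TensorE.induction {p : TensorE k A X Y → Prop} (t : TensorE k A X Y)
    (h0 : p 0) (h1 : ∀ x y, p (TensorE.tmul k A x y)) (h2 : ∀ s t, p s → p t → p (s + t)) :
    p t := by
  obtain ⟨s, rfl⟩ : ∃ s, TensorE.proj k A X Y s = t := (relE k A X Y).mkQ_surjective t
  induction s with
  | zero => rw [map_zero]; exact h0
  | tmul x y => exact h1 x y
  | add a b ha hb => rw [map_add]; exact h2 _ _ ha hb

theorem TensorA.balanced (a : A) (x : X) (y : Y) :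
    TensorA.tmul k A (Env.of k 1 a • x) y
      = TensorA.tmul k A x (Env.of k a 1 • y) := by
  rw [← sub_eq_zero, TensorA.tmul, TensorA.tmul, ← map_sub]
  exact (Submodule.Quotient.mk_eq_zero _).2 (Submodule.subset_span ⟨a, x, y, rfl⟩)

theorem TensorE.balanced (a b : A) (x : X) (y : Y) :
    TensorE.tmul k A (Env.of k b a • x) y
      = TensorE.tmul k A x (Env.of k a b • y) := by
  rw [← sub_eq_zero, TensorE.tmul, TensorE.tmul, ← map_sub]
  exact (Submodule.Quotient.mk_eq_zero _).2 (Submodule.subset_span ⟨a, b, x, y, rfl⟩)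

/-- A balanced `k`-bilinear map factors through `X ⊗_A Y`. -/
def TensorA.lift {Z : Type u} [AddCommGroup Z] [Module k Z] (f : X →ₗ[k] Y →ₗ[k] Z)
    (h : ∀ (a : A) (x : X) (y : Y), f (Env.of k 1 a • x) y
      = f x (Env.of k a 1 • y)) : TensorA k A X Y →ₗ[k] Z :=
  (relA k A X Y).liftQ (TensorProduct.lift f) (by
    rw [relA, Submodule.span_le]
    rintro _ ⟨a, x, y, rfl⟩
    simp [h])

theorem TensorA.lift_tmul {Z : Type u} [AddCommGroup Z] [Module k Z] (f : X →ₗ[k] Y →ₗ[k] Z) (h)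
    (x : X) (y : Y) : TensorA.lift (A := A) f h (TensorA.tmul k A x y) = f x y := by
  exact ((relA k A X Y).liftQ_apply _ _).trans (TensorProduct.lift.tmul x y)

/-- A balanced `k`-bilinear map factors through `X ⊗_{Aᵉ} Y`. -/
def TensorE.lift {Z : Type u} [AddCommGroup Z] [Module k Z] (f : X →ₗ[k] Y →ₗ[k] Z)
    (h : ∀ (a b : A) (x : X) (y : Y), f (Env.of k b a • x) y
      = f x (Env.of k a b • y)) : TensorE k A X Y →ₗ[k] Z :=
  (relE k A X Y).liftQ (TensorProduct.lift f) (by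
    rw [relE, Submodule.span_le]
    rintro _ ⟨a, b, x, y, rfl⟩
    simp [h])

theorem TensorE.lift_tmul {Z : Type u} [AddCommGroup Z] [Module k Z] (f : X →ₗ[k] Y →ₗ[k] Z) (h)
    (x : X) (y : Y) : TensorE.lift (A := A) f h (TensorE.tmul k A x y) = f x y := by
  exact ((relE k A X Y).liftQ_apply _ _).trans (TensorProduct.lift.tmul x y)

variable (k A X Y) in
/-- `(x, y) ↦ x ⊗ y` as a bilinear map to `X ⊗_A Y`. -/
def TensorA.mk₂ : X →ₗ[k] Y →ₗ[k] TensorA k A X Y :=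
  (TensorProduct.mk k X Y).compr₂ (TensorA.proj k A X Y)

variable (k A X Y) in
/-- `(x, y) ↦ x ⊗ y` as a bilinear map to `X ⊗_{Aᵉ} Y`. -/
def TensorE.mk₂ : X →ₗ[k] Y →ₗ[k] TensorE k A X Y :=
  (TensorProduct.mk k X Y).compr₂ (TensorE.proj k A X Y)

@[simp] theorem TensorA.mk₂_apply (x : X) (y : Y) :
    TensorA.mk₂ k A X Y x y = TensorA.tmul k A x y := rfl

@[simp] theorem TensorE.mk₂_apply (x : X) (y : Y) :
    TensorE.mk₂ k A X Y x y = TensorE.tmul k A x y := rfl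

theorem TensorA.hom_ext {Z : Type u} [AddCommGroup Z] [Module k Z]
    {f g : TensorA k A X Y →ₗ[k] Z}
    (h : ∀ x y, f (TensorA.tmul k A x y) = g (TensorA.tmul k A x y)) : f = g := by
  ext t
  induction t using TensorA.induction with
  | h0 => simp
  | h1 x y => exact h x y
  | h2 s t hs ht => simp [hs, ht]

theorem env_comm (a b : A) (x : X) :
    Env.of k a 1 • Env.of k 1 b • x = Env.of k 1 b • Env.of k a 1 • x := by
  rw [← mul_smul, ← mul_smul, Env.of_mul, Env.of_mul]; simp

variable (k X) in
/-- The action of the pure tensor `a ⊗ b°` as a linear map. -/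
def ofAct (a b : A) : X →ₗ[k] X := Algebra.lsmul k k X (Env.of k a b)

@[simp] theorem ofAct_apply (a b : A) (x : X) : ofAct k X a b x = Env.of k a b • x := rfl

theorem TensorA.add_tmul (x x' : X) (y : Y) : TensorA.tmul k A (x + x') y
    = TensorA.tmul k A x y + TensorA.tmul k A x' y :=
  LinearMap.map_add₂ (TensorA.mk₂ k A X Y) x x' y

theorem TensorA.tmul_add (x : X) (y y' : Y) : TensorA.tmul k A x (y + y')
    = TensorA.tmul k A x y + TensorA.tmul k A x y' :=
  map_add (TensorA.mk₂ k A X Y x) y y'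

theorem TensorA.smul_tmul' (c : k) (x : X) (y : Y) :
    TensorA.tmul k A (c • x) y = c • TensorA.tmul k A x y :=
  LinearMap.map_smul₂ (TensorA.mk₂ k A X Y) c x y

theorem TensorA.tmul_smul (c : k) (x : X) (y : Y) :
    TensorA.tmul k A x (c • y) = c • TensorA.tmul k A x y :=
  map_smul (TensorA.mk₂ k A X Y x) c y

/-- Left multiplication on `X ⊗_A Y`. -/
def TensorA.leftAct : A →ₐ[k] Module.End k (TensorA k A X Y) :=
  AlgHom.ofLinearMap
    { toFun := fun a => TensorA.lift ((TensorA.mk₂ k A X Y) ∘ₗ ofAct k X a 1)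
        (fun b x y => by
          simp only [LinearMap.comp_apply, ofAct_apply, TensorA.mk₂_apply]
          rw [env_comm, TensorA.balanced])
      map_add' := fun a b => TensorA.hom_ext fun x y => by
        simp [TensorA.lift_tmul, Env.add_of, add_smul]
      map_smul' := fun c a => TensorA.hom_ext fun x y => by
        simp [TensorA.lift_tmul, Env.smul_of] }
    (TensorA.hom_ext fun x y => by simp [TensorA.lift_tmul, Env.of_one])
    (fun a b => TensorA.hom_ext fun x y => by
      simp [TensorA.lift_tmul, ← mul_smul, Env.of_mul])

/-- Right multiplication on `X ⊗_A Y`. -/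
def TensorA.rightAct : Aᵐᵒᵖ →ₐ[k] Module.End k (TensorA k A X Y) :=
  AlgHom.ofLinearMap
    { toFun := fun b => TensorA.lift ((TensorA.mk₂ k A X Y).compl₂ (ofAct k Y 1 b.unop))
        (fun a x y => by
          simp only [LinearMap.compl₂_apply, ofAct_apply, TensorA.mk₂_apply]
          rw [TensorA.balanced, env_comm])
      map_add' := fun a b => TensorA.hom_ext fun x y => by
        simp [TensorA.lift_tmul, Env.of_add, add_smul, TensorA.tmul_add]
      map_smul' := fun c a => TensorA.hom_ext fun x y => by
        simp [TensorA.lift_tmul, Env.of_smul] }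
    (TensorA.hom_ext fun x y => by simp [TensorA.lift_tmul, Env.of_one])
    (fun a b => TensorA.hom_ext fun x y => by
      simp [TensorA.lift_tmul, ← mul_smul, Env.of_mul])

/-- The action of the enveloping algebra on `X ⊗_A Y`: `(a ⊗ b°)(x ⊗ y) = a x ⊗ y b`. -/
def TensorA.act : Env k A →ₐ[k] Module.End k (TensorA k A X Y) :=
  Algebra.TensorProduct.lift TensorA.leftAct TensorA.rightAct (fun a b => by
    apply TensorA.hom_ext
    intro x y
    simp [TensorA.leftAct, TensorA.rightAct, TensorA.lift_tmul])

instance : Module (Env k A) (TensorA k A X Y) :=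
  Module.compHom _ (TensorA.act (k := k) (A := A) (X := X) (Y := Y)).toRingHom

theorem TensorA.smul_eq (e : Env k A) (t : TensorA k A X Y) : e • t = TensorA.act e t := rfl

theorem TensorA.smul_tmul (a b : A) (x : X) (y : Y) :
    Env.of k a b • TensorA.tmul k A x y
      = TensorA.tmul k A (Env.of k a 1 • x) (Env.of k 1 b • y) := by
  have h : TensorA.act (Env.of k a b) (TensorA.tmul k A x y)
      = TensorA.leftAct a (TensorA.rightAct (op b) (TensorA.tmul k A x y)) :=
    congrArg (fun f : Module.End k (TensorA k A X Y) => f (TensorA.tmul k A x y))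
      (Algebra.TensorProduct.lift_tmul _ _ _ a (op b))
  rw [TensorA.smul_eq, h]
  simp [TensorA.leftAct, TensorA.rightAct, TensorA.lift_tmul]

instance : IsScalarTower k (Env k A) (TensorA k A X Y) where
  smul_assoc c e t := by simp [TensorA.smul_eq]

/-- To be linear over the enveloping algebra, a `k`-linear map has only to commute with
pure tensors. -/
def envLinear {Z W : Type u} [AddCommGroup Z] [Module k Z] [Module (Env k A) Z]
    [AddCommGroup W] [Module k W] [Module (Env k A) W]
    (f : Z →ₗ[k] W)
    (h : ∀ (a b : A) (z : Z), f (Env.of k a b • z) = Env.of k a b • f z) :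
    Z →ₗ[Env k A] W where
  toFun := f
  map_add' := f.map_add
  map_smul' e z := by
    induction e using Env.induction with
    | h0 => simp
    | h1 a b => exact h a b z
    | h2 e e' he he' => simp only [add_smul, map_add, he, he', RingHom.id_apply] at *

variable {X' Y' : Type u}
  [AddCommGroup X'] [Module k X'] [Module (Env k A) X'] [IsScalarTower k (Env k A) X']
  [AddCommGroup Y'] [Module k Y'] [Module (Env k A) Y'] [IsScalarTower k (Env k A) Y']

/-- `f ⊗_A g`, without signs. -/
def TensorA.map (f : X →ₗ[Env k A] X') (g : Y →ₗ[Env k A] Y') :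
    TensorA k A X Y →ₗ[Env k A] TensorA k A X' Y' :=
  envLinear (TensorA.lift
      ((TensorA.mk₂ k A X' Y').compl₁₂ (f.restrictScalars k) (g.restrictScalars k))
      (fun a x y => by simp [TensorA.balanced]))
    (fun a b z => by
      induction z using TensorA.induction with
      | h0 => simp
      | h1 x y => simp [TensorA.smul_tmul, TensorA.lift_tmul]
      | h2 s t hs ht => simp only [smul_add, map_add, hs, ht])

theorem TensorA.map_tmul (f : X →ₗ[Env k A] X') (g : Y →ₗ[Env k A] Y') (x : X) (y : Y) :
    TensorA.map f g (TensorA.tmul k A x y) = TensorA.tmul k A (f x) (g y) := by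
  simp only [TensorA.map, envLinear, LinearMap.coe_mk, AddHom.coe_mk]
  rw [TensorA.lift_tmul]; rfl

/-- `f ⊗_{Aᵉ} g`, without signs. -/
def TensorE.map (f : X →ₗ[Env k A] X') (g : Y →ₗ[Env k A] Y') :
    TensorE k A X Y →ₗ[k] TensorE k A X' Y' :=
  TensorE.lift
    ((TensorE.mk₂ k A X' Y').compl₁₂ (f.restrictScalars k) (g.restrictScalars k))
    (fun a b x y => by simp [TensorE.balanced])

theorem TensorE.map_tmul (f : X →ₗ[Env k A] X') (g : Y →ₗ[Env k A] Y') (x : X) (y : Y) :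
    TensorE.map f g (TensorE.tmul k A x y) = TensorE.tmul k A (f x) (g y) :=
  TensorE.lift_tmul _ _ x y

variable (k A) in
/-- The canonical isomorphism `A ⊗_A A → A`, `a ⊗ b ↦ ab`. -/
def mulA : TensorA k A A A →ₗ[Env k A] A :=
  envLinear (TensorA.lift (LinearMap.mul k A)
      (fun a x y => by simp [env_smul_def, mul_assoc]))
    (fun a b z => by
      induction z using TensorA.induction with
      | h0 => simp
      | h1 x y => simp [TensorA.smul_tmul, TensorA.lift_tmul, env_smul_def, mul_assoc]
      | h2 s t hs ht => simp only [smul_add, map_add, hs, ht])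

theorem mulA_tmul (x y : A) : mulA k A (TensorA.tmul k A x y) = x * y := by
  simp only [mulA, envLinear, LinearMap.coe_mk, AddHom.coe_mk]
  rw [TensorA.lift_tmul]; rfl

end Tensor

/-! ## Subquotients -/

section SubQ

variable {V V₁ V₂ V₃ : Type u} [AddCommGroup V] [Module k V] [AddCommGroup V₁] [Module k V₁]
  [AddCommGroup V₂] [Module k V₂] [AddCommGroup V₃] [Module k V₃]

/-- The quotient of the cycles `Z` by the boundaries `B` (which lie in `Z` in all uses). -/
abbrev SubQ (Z B : Submodule k V) : Type u := Z ⧸ B.submoduleOf Z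

instance (Z B : Submodule k V) : AddCommMonoid (SubQ Z B) :=
  Submodule.Quotient.addCommMonoid (B.submoduleOf Z)

instance (Z B : Submodule k V) : Module k (SubQ Z B) :=
  Submodule.Quotient.module (B.submoduleOf Z)

/-- The map induced on subquotients by a bilinear map. -/
def SubQ.bilin {Z₁ B₁ : Submodule k V₁} {Z₂ B₂ : Submodule k V₂} {Z₃ B₃ : Submodule k V₃}
    (β : V₁ →ₗ[k] V₂ →ₗ[k] V₃)
    (hZ : ∀ x ∈ Z₁, ∀ y ∈ Z₂, β x y ∈ Z₃)
    (h₁ : ∀ x ∈ B₁, ∀ y ∈ Z₂, β x y ∈ B₃)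
    (h₂ : ∀ x ∈ Z₁, ∀ y ∈ B₂, β x y ∈ B₃) :
    SubQ Z₁ B₁ →ₗ[k] SubQ Z₂ B₂ →ₗ[k] SubQ Z₃ B₃ :=
  let γ : Z₁ →ₗ[k] Z₂ →ₗ[k] SubQ Z₃ B₃ := LinearMap.mk₂ k
    (fun x y => Submodule.Quotient.mk ⟨β x y, hZ x x.2 y y.2⟩)
    (fun x x' y => by rw [← Submodule.Quotient.mk_add]; congr 1; ext; simp)
    (fun c x y => by rw [← Submodule.Quotient.mk_smul]; congr 1; ext; simp)
    (fun x y y' => by rw [← Submodule.Quotient.mk_add]; congr 1; ext; simp)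
    (fun c x y => by rw [← Submodule.Quotient.mk_smul]; congr 1; ext; simp)
  (B₁.submoduleOf Z₁).liftQ
    (LinearMap.flip ((B₂.submoduleOf Z₂).liftQ γ.flip (by
      intro y hy
      ext x
      exact (Submodule.Quotient.mk_eq_zero _).2 (h₂ x x.2 y hy))))
    (by
      intro x hx
      refine LinearMap.ext fun y => ?_
      obtain ⟨y, rfl⟩ := Submodule.Quotient.mk_surjective _ y
      exact (Submodule.Quotient.mk_eq_zero _).2 (h₁ x hx y y.2))

theorem SubQ.bilin_mk {Z₁ B₁ : Submodule k V₁} {Z₂ B₂ : Submodule k V₂} {Z₃ B₃ : Submodule k V₃}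
    (β : V₁ →ₗ[k] V₂ →ₗ[k] V₃) (hZ) (h₁) (h₂) (x : Z₁) (y : Z₂) :
    SubQ.bilin (B₁ := B₁) (B₂ := B₂) (B₃ := B₃) β hZ h₁ h₂
      (Submodule.Quotient.mk x) (Submodule.Quotient.mk y)
      = Submodule.Quotient.mk (⟨β x y, hZ x x.2 y y.2⟩ : Z₃) := rfl

end SubQ

/-! ## Complexes and complete resolutions -/

/-- The sign `(-1)^n`. -/
def sgn (n : ℤ) : ℤ := (Int.negOnePow n : ℤˣ)

section Complexes

variable (k A) in
/-- Chain complexes of bimodules, indexed by all integers. -/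
abbrev Cx : Type (u + 1) := ChainComplex (ModuleCat.{u} (Env k A)) ℤ

/-- The differential `C_i → C_j` (which is zero unless `i = j + 1`) as a linear map. -/
abbrev dd (C : Cx k A) (i j : ℤ) : C.X i →ₗ[Env k A] C.X j := (C.d i j).hom

theorem dd_dd (C : Cx k A) (i j l : ℤ) (x : C.X i) : dd C j l (dd C i j x) = 0 := by
  exact congrArg (fun f => f.hom x) (C.d_comp_d i j l)

variable (k A) in
/-- A complete resolution of a bimodule `M`: an exact complex `T` of finitely generated projective
bimodules whose dual `Hom(T, Aᵉ)` is exact too, with an augmentation `T_0 → M` that makes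
`⋯ → T_1 → T_0 → M → 0` a projective resolution. -/
structure CompleteResolution (M : Type u) [AddCommGroup M] [Module (Env k A) M] where
  complex : Cx k A
  finite : ∀ i, Module.Finite (Env k A) (complex.X i)
  projective : ∀ i, Module.Projective (Env k A) (complex.X i)
  exact : ∀ i, Function.Exact (dd complex (i + 1) i) (dd complex i (i - 1))
  dual_exact : ∀ i, Function.Exact
    (pre (dd complex i (i - 1)) (Env k A)) (pre (dd complex (i + 1) i) (Env k A))
  aug : complex.X 0 →ₗ[Env k A] M
  aug_surjective : Function.Surjective aug
  aug_exact : Function.Exact (dd complex 1 0) aug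

namespace CompleteResolution

variable {M : Type u} [AddCommGroup M] [Module (Env k A) M] (T : CompleteResolution k A M)

/-- `Ω^i M = Ker d_{i-1} ⊆ T_{i-1}`: syzygies for `i ≥ 0`, cosyzygies for `i < 0`. -/
abbrev syzygy (i : ℤ) : Submodule (Env k A) (T.complex.X (i - 1)) :=
  LinearMap.ker (dd T.complex (i - 1) (i - 1 - 1))

/-- The epimorphism `π_i : T_i → Ω^i M` through which `d_i` factors. -/
def proj (i : ℤ) : T.complex.X i →ₗ[Env k A] T.syzygy i :=
  (dd T.complex i (i - 1)).codRestrict _ (fun x => dd_dd _ _ _ _ x)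

end CompleteResolution

/-- The pairs of integers of sum `n`. -/
abbrev Bideg (n : ℤ) : Type := {s : ℤ × ℤ // s.1 + s.2 = n}

/-- The differential of the complete tensor product over `A`: the component in bidegree `(p, q)` of
the image of `w` is `(d ⊗ id) w_{p+1,q} + (-1)^p (id ⊗ d) w_{p,q+1}`. -/
def completeTensorD (C D : Cx k A) (n m : ℤ) (h : m + 1 = n) :
    (∀ s : Bideg n, TensorA k A (C.X s.1.1) (D.X s.1.2)) →ₗ[Env k A]
      (∀ s : Bideg m, TensorA k A (C.X s.1.1) (D.X s.1.2)) :=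
  LinearMap.pi fun s =>
    TensorA.map (dd C (s.1.1 + 1) s.1.1) LinearMap.id ∘ₗ
        LinearMap.proj (⟨(s.1.1 + 1, s.1.2), by have := s.2; grind⟩ : Bideg n)
      + sgn s.1.1 • (TensorA.map LinearMap.id (dd D (s.1.2 + 1) s.1.2) ∘ₗ
        LinearMap.proj (⟨(s.1.1, s.1.2 + 1), by have := s.2; grind⟩ : Bideg n))

theorem TensorA.map_map_zero {X Y X' Y' X'' Y'' : Type u}
    [AddCommGroup X] [Module k X] [Module (Env k A) X] [IsScalarTower k (Env k A) X]
    [AddCommGroup Y] [Module k Y] [Module (Env k A) Y] [IsScalarTower k (Env k A) Y]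
    [AddCommGroup X'] [Module k X'] [Module (Env k A) X'] [IsScalarTower k (Env k A) X']
    [AddCommGroup Y'] [Module k Y'] [Module (Env k A) Y'] [IsScalarTower k (Env k A) Y']
    [AddCommGroup X''] [Module k X''] [Module (Env k A) X''] [IsScalarTower k (Env k A) X'']
    [AddCommGroup Y''] [Module k Y''] [Module (Env k A) Y''] [IsScalarTower k (Env k A) Y'']
    (f : X →ₗ[Env k A] X') (g : Y →ₗ[Env k A] Y') (f' : X' →ₗ[Env k A] X'')
    (g' : Y' →ₗ[Env k A] Y'') (h : (∀ x, f' (f x) = 0) ∨ (∀ y, g' (g y) = 0))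
    (t : TensorA k A X Y) : TensorA.map f' g' (TensorA.map f g t) = 0 := by
  induction t using TensorA.induction with
  | h0 => simp
  | h1 x y =>
    rw [TensorA.map_tmul, TensorA.map_tmul]
    rcases h with h | h
    · rw [h, ← TensorA.mk₂_apply, map_zero, LinearMap.zero_apply]
    · rw [h, ← TensorA.mk₂_apply, map_zero]
  | h2 s t hs ht => simp [hs, ht]

theorem TensorA.map_comm {X Y X' Y' : Type u}
    [AddCommGroup X] [Module k X] [Module (Env k A) X] [IsScalarTower k (Env k A) X]
    [AddCommGroup Y] [Module k Y] [Module (Env k A) Y] [IsScalarTower k (Env k A) Y]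
    [AddCommGroup X'] [Module k X'] [Module (Env k A) X'] [IsScalarTower k (Env k A) X']
    [AddCommGroup Y'] [Module k Y'] [Module (Env k A) Y'] [IsScalarTower k (Env k A) Y']
    (f : X →ₗ[Env k A] X') (g : Y →ₗ[Env k A] Y') (t : TensorA k A X Y) :
    TensorA.map f LinearMap.id (TensorA.map LinearMap.id g t)
      = TensorA.map LinearMap.id g (TensorA.map f LinearMap.id t) := by
  induction t using TensorA.induction with
  | h0 => simp
  | h1 x y => simp [TensorA.map_tmul]
  | h2 s t hs ht => simp [hs, ht]

theorem sgn_mul_self (n : ℤ) : sgn n * sgn n = 1 := by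
  rw [sgn, ← Units.val_mul, ← sq, Int.units_sq, Units.val_one]

theorem sgn_succ (n : ℤ) : sgn (n + 1) = - sgn n := by
  simp [sgn, Int.negOnePow_succ]

theorem completeTensorD_comp (C D : Cx k A) (n m l : ℤ) (h : m + 1 = n) (h' : l + 1 = m)
    (w : ∀ s : Bideg n, TensorA k A (C.X s.1.1) (D.X s.1.2)) :
    completeTensorD C D m l h' (completeTensorD C D n m h w) = 0 := by
  funext s
  simp only [completeTensorD, LinearMap.pi_apply, LinearMap.add_apply, LinearMap.comp_apply,
    LinearMap.proj_apply, LinearMap.smul_apply, map_add, map_zsmul, Pi.zero_apply, sgn_succ]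
  rw [TensorA.map_map_zero _ _ _ _ (Or.inl (dd_dd C _ _ _)),
    TensorA.map_map_zero _ _ _ _ (Or.inr (dd_dd D _ _ _)), TensorA.map_comm]
  simp

/-- The complete tensor product `C ⊗̂_A D`, with `n`-th component `∏_{p+q=n} C_p ⊗_A D_q`. -/
def completeTensor (C D : Cx k A) : Cx k A where
  X n := ModuleCat.of (Env k A) (∀ s : Bideg n, TensorA k A (C.X s.1.1) (D.X s.1.2))
  d n m := if h : m + 1 = n then ModuleCat.ofHom (completeTensorD C D n m h) else 0
  shape n m h := dif_neg h
  d_comp_d' n m l h h' := by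
    have h₁ : m + 1 = n := h
    have h₂ : l + 1 = m := h'
    rw [dif_pos h₁, dif_pos h₂]
    refine ModuleCat.hom_ext (LinearMap.ext fun w => ?_)
    exact completeTensorD_comp C D n m l h₁ h₂ w

/-- A diagonal approximation: a chain map `T → T ⊗̂_A T` with `(ε ⊗̂ ε) Δ = ε`. -/
structure DiagonalApproximation (T : CompleteResolution k A A) where
  hom : T.complex ⟶ completeTensor T.complex T.complex
  aug : ∀ x : T.complex.X 0,
    mulA k A (TensorA.map T.aug T.aug
      ((hom.f 0).hom x (⟨(0, 0), by simp⟩ : Bideg 0))) = T.aug x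

namespace DiagonalApproximation

variable {T : CompleteResolution k A A} (Δ : DiagonalApproximation T)

/-- The component `T_n → T_p ⊗_A T_q` of a diagonal approximation. -/
def comp (n p q : ℤ) (h : p + q = n) :
    T.complex.X n →ₗ[Env k A] TensorA k A (T.complex.X p) (T.complex.X q) :=
  LinearMap.proj (R := Env k A)
    (φ := fun s : Bideg n => TensorA k A (T.complex.X s.1.1) (T.complex.X s.1.2)) ⟨(p, q), h⟩
    ∘ₗ (Δ.hom.f n).hom

theorem comp_d (n p q n' p' q' : ℤ) (h : p + q = n) (hn : n + 1 = n') (hp : p + 1 = p')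
    (hq : q + 1 = q') (x : T.complex.X n') :
    Δ.comp n p q h (dd T.complex n' n x)
      = TensorA.map (dd T.complex p' p) LinearMap.id (Δ.comp n' p' q (by omega) x)
        + sgn p • TensorA.map LinearMap.id (dd T.complex q' q)
          (Δ.comp n' p q' (by omega) x) := by
  subst hn hp hq
  have := congrArg (fun f => (f.hom x : ∀ s : Bideg n,
    TensorA k A (T.complex.X s.1.1) (T.complex.X s.1.2)) ⟨(p, q), h⟩) (Δ.hom.comm (n + 1) n)
  have h2 : (completeTensor T.complex T.complex).d (n + 1) n
    = ModuleCat.ofHom (completeTensorD T.complex T.complex (n + 1) n rfl) := dif_pos rfl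
  rw [h2] at this
  exact this.symm

end DiagonalApproximation

/-! ## Tate-Hochschild cohomology and homology -/

section TateGroups

variable (T : CompleteResolution k A A)

/-- The `n`-cocycles of `Hom(T, A)`: maps `u : T_n → A` with `u d = 0`. -/
def cocycles (n : ℤ) : Submodule k (T.complex.X n →ₗ[Env k A] A) :=
  LinearMap.ker (pre (dd T.complex (n + 1) n) A)

/-- The `n`-coboundaries of `Hom(T, A)`: maps `h d` with `h : T_{n-1} → A`. -/
def coboundaries (n : ℤ) : Submodule k (T.complex.X n →ₗ[Env k A] A) :=
  LinearMap.range (pre (dd T.complex n (n - 1)) A)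

/-- The Tate-Hochschild cohomology group `Ĥ^n(A, A) = H^n(Hom(T, A))`. -/
abbrev TateCohomology (n : ℤ) : Type u := SubQ (cocycles T n) (coboundaries T n)

variable (M : Type u) [AddCommGroup M] [Module k M] [Module (Env k A) M]
  [IsScalarTower k (Env k A) M]

/-- The differential `T_i ⊗ M → T_j ⊗ M`. -/
def homologyD (i j : ℤ) : TensorE k A (T.complex.X i) M →ₗ[k] TensorE k A (T.complex.X j) M :=
  TensorE.map (dd T.complex i j) LinearMap.id

/-- The `n`-cycles of `T ⊗ M`. -/
def cycles (n : ℤ) : Submodule k (TensorE k A (T.complex.X n) M) :=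
  LinearMap.ker (homologyD T M n (n - 1))

/-- The `n`-boundaries of `T ⊗ M`. -/
def boundaries (n : ℤ) : Submodule k (TensorE k A (T.complex.X n) M) :=
  LinearMap.range (homologyD T M (n + 1) n)

/-- The Tate-Hochschild homology group `Ĥ_n(A, M) = H_n(T ⊗ M)`. -/
abbrev TateHomology (n : ℤ) : Type u := SubQ (cycles T M n) (boundaries T M n)

end TateGroups

/-! ## Cup and cap product -/

section Products

variable {T : CompleteResolution k A A} (Δ : DiagonalApproximation T)

section Pairings

variable {X Y Z M : Type u}
    [AddCommGroup X] [Module k X] [Module (Env k A) X] [IsScalarTower k (Env k A) X]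
    [AddCommGroup Y] [Module k Y] [Module (Env k A) Y] [IsScalarTower k (Env k A) Y]
    [AddCommGroup Z] [Module k Z] [Module (Env k A) Z] [IsScalarTower k (Env k A) Z]
    [AddCommGroup M] [Module k M] [Module (Env k A) M] [IsScalarTower k (Env k A) M]

/-- For `D : Z → X ⊗_A Y`, the pairing `(u, v) ↦ μ (u ⊗ v) D`, without signs. -/
def cupMap (D : Z →ₗ[Env k A] TensorA k A X Y) :
    (X →ₗ[Env k A] A) →ₗ[k] (Y →ₗ[Env k A] A) →ₗ[k] (Z →ₗ[Env k A] A) :=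
  LinearMap.mk₂ k (fun u v => mulA k A ∘ₗ TensorA.map u v ∘ₗ D)
    (fun u u' v => by
      ext z
      simp only [LinearMap.comp_apply, LinearMap.add_apply]
      induction D z using TensorA.induction with
      | h0 => simp
      | h1 x y => simp [TensorA.map_tmul, mulA_tmul, add_mul]
      | h2 s t hs ht => simp only [map_add, hs, ht]; abel)
    (fun c u v => by
      ext z
      simp only [LinearMap.comp_apply, LinearMap.smul_apply]
      induction D z using TensorA.induction with
      | h0 => simp
      | h1 x y => simp [TensorA.map_tmul, mulA_tmul]
      | h2 s t hs ht => simp only [map_add, smul_add, hs, ht])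
    (fun u v v' => by
      ext z
      simp only [LinearMap.comp_apply, LinearMap.add_apply]
      induction D z using TensorA.induction with
      | h0 => simp
      | h1 x y => simp [TensorA.map_tmul, mulA_tmul, mul_add]
      | h2 s t hs ht => simp only [map_add, hs, ht]; abel)
    (fun c u v => by
      ext z
      simp only [LinearMap.comp_apply, LinearMap.smul_apply]
      induction D z using TensorA.induction with
      | h0 => simp
      | h1 x y => simp [TensorA.map_tmul, mulA_tmul]
      | h2 s t hs ht => simp only [map_add, smul_add, hs, ht])

/-- The left action of `A` on a bimodule, `(a, m) ↦ a m`. -/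
def leftMul : A →ₗ[k] M →ₗ[k] M :=
  LinearMap.mk₂ k (fun a m => Env.of k a 1 • m)
    (fun a b m => by rw [Env.add_of, add_smul])
    (fun c a m => by rw [Env.smul_of, smul_assoc])
    (fun a m m' => smul_add _ m m')
    (fun c a m => smul_comm _ c m)

theorem leftMul_apply (a : A) (m : M) :
    leftMul (k := k) a m = Env.of k a 1 • m := rfl

variable (M) in
/-- `(x ⊗_A y, m) ↦ x ⊗_{Aᵉ} u(y) m`. -/
def contract (u : Y →ₗ[Env k A] A) : TensorA k A X Y →ₗ[k] M →ₗ[k] TensorE k A X M :=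
  TensorA.lift
    (LinearMap.mk₂ k (fun x y => TensorE.mk₂ k A X M x ∘ₗ leftMul (k := k) (u y))
      (fun x x' y => by simp [LinearMap.add_comp])
      (fun c x y => by simp [LinearMap.smul_comp])
      (fun x y y' => by simp [LinearMap.comp_add])
      (fun c x y => by simp [LinearMap.comp_smul]))
    (fun a x y => by
      ext m
      simp only [LinearMap.mk₂_apply, LinearMap.comp_apply, TensorE.mk₂_apply, leftMul_apply]
      rw [TensorE.balanced, map_smul, env_smul_def, ← mul_smul, Env.of_mul]
      simp)

theorem contract_tmul (u : Y →ₗ[Env k A] A) (x : X) (y : Y) (m : M) :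
    contract M u (TensorA.tmul k A x y) m
      = TensorE.tmul k A x (Env.of k (u y) 1 • m) := by
  rw [contract, TensorA.lift_tmul]; rfl

theorem contract_smul (u : Y →ₗ[Env k A] A) (a b : A) (t : TensorA k A X Y) (m : M) :
    contract M u (Env.of k b a • t) m
      = contract M u t (Env.of k a b • m) := by
  induction t using TensorA.induction with
  | h0 => simp
  | h1 x y =>
    rw [TensorA.smul_tmul, contract_tmul, contract_tmul]
    rw [TensorE.balanced, map_smul, env_smul_def, ← mul_smul, ← mul_smul, Env.of_mul, Env.of_mul]
    simp
  | h2 s t hs ht => simp only [smul_add, map_add, LinearMap.add_apply, hs, ht]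

variable (M) in
/-- For `D : Z → X ⊗_A Y` and `u : Y → A`, the map `Z ⊗_{Aᵉ} M → X ⊗_{Aᵉ} M` that sends `z ⊗ m`
with `D z = ∑ x ⊗ y` to `∑ x ⊗ u(y) m`, without signs. -/
def capMap (D : Z →ₗ[Env k A] TensorA k A X Y) :
    (Y →ₗ[Env k A] A) →ₗ[k] TensorE k A Z M →ₗ[k] TensorE k A X M :=
  LinearMap.mk₂ k
    (fun u t => TensorE.lift (contract M u ∘ₗ D.restrictScalars k)
      (fun a b z m => by
        simp only [LinearMap.comp_apply, LinearMap.restrictScalars_apply]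
        rw [map_smul, contract_smul]) t)
    (fun u u' t => by
      induction t using TensorE.induction with
      | h0 => simp
      | h1 z m =>
        simp only [TensorE.lift_tmul, LinearMap.comp_apply, LinearMap.restrictScalars_apply]
        induction D z using TensorA.induction with
        | h0 => simp
        | h1 x y =>
          simp only [contract_tmul, LinearMap.add_apply, Env.add_of, add_smul]
          exact map_add (TensorE.mk₂ k A X M x) _ _
        | h2 s t hs ht => simp only [map_add, LinearMap.add_apply, hs, ht]; abel
      | h2 s t hs ht => simp only [map_add, hs, ht]; abel)
    (fun c u t => by
      induction t using TensorE.induction with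
      | h0 => simp
      | h1 z m =>
        simp only [TensorE.lift_tmul, LinearMap.comp_apply, LinearMap.restrictScalars_apply]
        induction D z using TensorA.induction with
        | h0 => simp
        | h1 x y =>
          simp only [contract_tmul, LinearMap.smul_apply, Env.smul_of, smul_assoc]
          exact map_smul (TensorE.mk₂ k A X M x) _ _
        | h2 s t hs ht => simp only [map_add, LinearMap.add_apply, smul_add, hs, ht]
      | h2 s t hs ht => simp only [map_add, smul_add, hs, ht])
    (fun u t t' => map_add _ _ _)
    (fun c u t => map_smul _ _ _)

theorem capMap_tmul (D : Z →ₗ[Env k A] TensorA k A X Y) (u : Y →ₗ[Env k A] A) (z : Z) (m : M) :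
    capMap M D u (TensorE.tmul k A z m) = contract M u (D z) m := by
  rw [capMap, LinearMap.mk₂_apply, TensorE.lift_tmul]; rfl

end Pairings

/-- The cup product of cochains, `u ⌣ v = (u ⊗̂ v) Δ`; on `T_i ⊗_A T_j` the map `u ⊗̂ v` is
`x ⊗ y ↦ (-1)^{ij} u(x) v(y)`, and it is zero on all other components. -/
def cupCochain (i j : ℤ) :
    (T.complex.X i →ₗ[Env k A] A) →ₗ[k] (T.complex.X j →ₗ[Env k A] A) →ₗ[k]
      (T.complex.X (i + j) →ₗ[Env k A] A) :=
  sgn (i * j) • cupMap (Δ.comp (i + j) i j rfl)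

/-- The cap product of cochains and chains: `u ⌢ (x ⊗ m)` is the sum of the
`(-1)^{|u||x'|} x' ⊗ u(x'') m` over the terms `x' ⊗ x''` of `Δ x` with `x''` of degree `i`. -/
def capChain (M : Type u) [AddCommGroup M] [Module k M] [Module (Env k A) M]
    [IsScalarTower k (Env k A) M] (i j : ℤ) :
    (T.complex.X i →ₗ[Env k A] A) →ₗ[k] TensorE k A (T.complex.X j) M →ₗ[k]
      TensorE k A (T.complex.X (j - i)) M :=
  sgn (i * (j - i)) • capMap M (Δ.comp j (j - i) i (sub_add_cancel j i))

section WellDefined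

variable (n p q n' p' q' : ℤ) (h : p + q = n) (hn : n + 1 = n') (hp : p + 1 = p')
  (hq : q + 1 = q')

/-- Leibniz rule for the cup product, without the overall sign. -/
theorem cupMap_d (u : T.complex.X p →ₗ[Env k A] A) (v : T.complex.X q →ₗ[Env k A] A) :
    cupMap (Δ.comp n p q h) u v ∘ₗ dd T.complex n' n
      = cupMap (Δ.comp n' p' q (by omega)) (u ∘ₗ dd T.complex p' p) v
        + sgn p • cupMap (Δ.comp n' p q' (by omega)) u (v ∘ₗ dd T.complex q' q) := by
  ext x
  simp only [cupMap, LinearMap.mk₂_apply, LinearMap.comp_apply, LinearMap.add_apply,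
    LinearMap.smul_apply, Δ.comp_d n p q n' p' q' h hn hp hq, map_add, map_zsmul]
  congr 1
  · induction Δ.comp n' p' q (by omega) x using TensorA.induction with
    | h0 => simp
    | h1 x y => simp [TensorA.map_tmul]
    | h2 s t hs ht => simp only [map_add, hs, ht]
  · congr 1
    induction Δ.comp n' p q' (by omega) x using TensorA.induction with
    | h0 => simp
    | h1 x y => simp [TensorA.map_tmul]
    | h2 s t hs ht => simp only [map_add, hs, ht]

/-- Leibniz rule for the cap product, without the overall sign. -/
theorem capMap_d (M : Type u) [AddCommGroup M] [Module k M] [Module (Env k A) M]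
    [IsScalarTower k (Env k A) M]
    (u : T.complex.X q →ₗ[Env k A] A) (z : TensorE k A (T.complex.X n') M) :
    capMap M (Δ.comp n p q h) u (homologyD T M n' n z)
      = homologyD T M p' p (capMap M (Δ.comp n' p' q (by omega)) u z)
        + sgn p • capMap M (Δ.comp n' p q' (by omega)) (u ∘ₗ dd T.complex q' q) z := by
  induction z using TensorE.induction with
  | h0 => simp
  | h1 x m =>
    simp only [homologyD, TensorE.map_tmul, capMap_tmul, LinearMap.id_apply,
      Δ.comp_d n p q n' p' q' h hn hp hq, map_add, map_zsmul, LinearMap.add_apply,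
      LinearMap.smul_apply]
    congr 1
    · induction Δ.comp n' p' q (by omega) x using TensorA.induction with
      | h0 => simp
      | h1 x y => simp [TensorA.map_tmul, contract_tmul, TensorE.map_tmul]
      | h2 s t hs ht => simp only [map_add, LinearMap.add_apply, hs, ht]
    · congr 1
      induction Δ.comp n' p q' (by omega) x using TensorA.induction with
      | h0 => simp
      | h1 x y => simp [TensorA.map_tmul, contract_tmul]
      | h2 s t hs ht => simp only [map_add, LinearMap.add_apply, hs, ht]
  | h2 s t hs ht => simp only [map_add, smul_add, hs, ht]; abel

end WellDefined

theorem mem_cocycles {n : ℤ} {u : T.complex.X n →ₗ[Env k A] A} :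
    u ∈ cocycles T n ↔ u ∘ₗ dd T.complex (n + 1) n = 0 := Iff.rfl

theorem cocycle_comp {n n' : ℤ} (hn : n + 1 = n') {u : T.complex.X n →ₗ[Env k A] A}
    (hu : u ∈ cocycles T n) : u ∘ₗ dd T.complex n' n = 0 := by
  subst hn; exact hu

/-- The cup product `Ĥ^i(A, A) ⊗ Ĥ^j(A, A) → Ĥ^{i+j}(A, A)`. -/
def cup (i j : ℤ) :
    TateCohomology T i →ₗ[k] TateCohomology T j →ₗ[k] TateCohomology T (i + j) :=
  SubQ.bilin (cupCochain Δ i j)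
    (fun u hu v hv => by
      change sgn (i * j) • (cupMap (Δ.comp (i + j) i j rfl) u v
        ∘ₗ dd T.complex (i + j + 1) (i + j)) = 0
      rw [cupMap_d Δ (i + j) i j (i + j + 1) (i + 1) (j + 1) rfl rfl rfl rfl,
        cocycle_comp rfl hu, cocycle_comp rfl hv]
      simp)
    (fun u hu v hv => by
      obtain ⟨h, rfl⟩ := hu
      refine ⟨sgn (i * j) • cupMap (Δ.comp (i + j - 1) (i - 1) j (by omega)) h v, ?_⟩
      change sgn (i * j) • (cupMap (Δ.comp (i + j - 1) (i - 1) j (by omega)) h v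
        ∘ₗ dd T.complex (i + j) (i + j - 1)) = sgn (i * j) • cupMap (Δ.comp (i + j) i j rfl)
          (h ∘ₗ dd T.complex i (i - 1)) v
      rw [cupMap_d Δ (i + j - 1) (i - 1) j (i + j) i (j + 1) (by omega) (by omega) (by omega) rfl,
        cocycle_comp rfl hv]
      simp)
    (fun u hu v hv => by
      obtain ⟨h, rfl⟩ := hv
      refine ⟨sgn (i * j) • sgn i • cupMap (Δ.comp (i + j - 1) i (j - 1) (by omega)) u h, ?_⟩
      change sgn (i * j) • sgn i • (cupMap (Δ.comp (i + j - 1) i (j - 1) (by omega)) u h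
        ∘ₗ dd T.complex (i + j) (i + j - 1)) = sgn (i * j) • cupMap (Δ.comp (i + j) i j rfl)
          u (h ∘ₗ dd T.complex j (j - 1))
      rw [cupMap_d Δ (i + j - 1) i (j - 1) (i + j) (i + 1) j (by omega) (by omega) rfl (by omega),
        cocycle_comp rfl hu]
      simp [smul_smul, sgn_mul_self])

/-- The cap product `Ĥ^i(A, A) ⊗ Ĥ_j(A, M) → Ĥ_{j-i}(A, M)`. -/
def cap (M : Type u) [AddCommGroup M] [Module k M] [Module (Env k A) M]
    [IsScalarTower k (Env k A) M] (i j : ℤ) :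
    TateCohomology T i →ₗ[k] TateHomology T M j →ₗ[k] TateHomology T M (j - i) :=
  SubQ.bilin (capChain Δ M i j)
    (fun u hu z hz => by
      change homologyD T M (j - i) (j - i - 1)
        (sgn (i * (j - i)) • capMap M (Δ.comp j (j - i) i (sub_add_cancel j i)) u z) = 0
      have := capMap_d Δ (j - 1) (j - i - 1) i j (j - i) (i + 1) (by omega) (by omega) (by omega)
        rfl M u z
      rw [show homologyD T M j (j - 1) z = 0 from hz, cocycle_comp rfl hu] at this
      simp only [map_zero, LinearMap.zero_apply, smul_zero, add_zero] at this
      rw [map_zsmul, ← this, smul_zero])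
    (fun u hu z hz => by
      obtain ⟨h, rfl⟩ := hu
      have := capMap_d Δ (j - 1) (j - i) (i - 1) j (j - i + 1) i (by omega) (by omega) rfl
        (by omega) M h z
      rw [show homologyD T M j (j - 1) z = 0 from hz, map_zero] at this
      refine ⟨- (sgn (i * (j - i)) • sgn (j - i) •
        capMap M (Δ.comp j (j - i + 1) (i - 1) (by omega)) h z), ?_⟩
      change homologyD T M (j - i + 1) (j - i) _ = sgn (i * (j - i)) •
        capMap M (Δ.comp j (j - i) i (sub_add_cancel j i)) (h ∘ₗ dd T.complex i (i - 1)) z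
      rw [map_neg, map_zsmul, map_zsmul, eq_neg_of_add_eq_zero_left this.symm]
      simp [smul_smul, sgn_mul_self])
    (fun u hu z hz => by
      obtain ⟨c, rfl⟩ := hz
      have := capMap_d Δ j (j - i) i (j + 1) (j - i + 1) (i + 1) (by omega) rfl rfl rfl M u c
      rw [cocycle_comp rfl hu] at this
      simp only [map_zero, LinearMap.zero_apply, smul_zero, add_zero] at this
      refine ⟨sgn (i * (j - i)) • capMap M (Δ.comp (j + 1) (j - i + 1) i (by omega)) u c, ?_⟩
      rw [map_zsmul, ← this]
      rfl)

variable (T) in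
/-- The augmentation is a cocycle of degree `0`. -/
theorem aug_mem_cocycles : T.aug ∈ cocycles T 0 :=
  LinearMap.ext fun x => (T.aug_exact _).2 ⟨x, rfl⟩

variable (T) in
/-- The unit of the Tate-Hochschild cohomology ring, the class of the augmentation. -/
def tateOne : TateCohomology T 0 := Submodule.Quotient.mk ⟨T.aug, aug_mem_cocycles T⟩

end Products

end Complexes

/-! ## Stable morphisms and stable tensor products -/

section Stable

variable (X Y : Type u)
  [AddCommGroup X] [Module k X] [Module (Env k A) X] [IsScalarTower k (Env k A) X]
  [AddCommGroup Y] [Module k Y] [Module (Env k A) Y] [IsScalarTower k (Env k A) Y]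

/-- The morphisms `X → Y` that factor through a projective bimodule. -/
def projHoms : Submodule k (X →ₗ[Env k A] Y) where
  carrier := {f | ∃ (P : Type u) (_ : AddCommGroup P) (_ : Module (Env k A) P)
    (g : X →ₗ[Env k A] P) (h : P →ₗ[Env k A] Y), Module.Projective (Env k A) P ∧ f = h ∘ₗ g}
  zero_mem' := ⟨PUnit, inferInstance, inferInstance, 0, 0, inferInstance, rfl⟩
  add_mem' := by
    rintro _ _ ⟨P, _, _, g, h, _, rfl⟩ ⟨P', _, _, g', h', _, rfl⟩
    exact ⟨P × P', inferInstance, inferInstance, g.prod g', h.coprod h', inferInstance, by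
      ext x; simp⟩
  smul_mem' := by
    rintro c _ ⟨P, _, _, g, h, _, rfl⟩
    exact ⟨P, inferInstance, inferInstance, g, c • h, inferInstance, rfl⟩

/-- Morphisms in the projectively stable category of bimodules. -/
abbrev StableHom : Type u := (X →ₗ[Env k A] Y) ⧸ projHoms (k := k) X Y

/-- The stable tensor product: the elements of `X ⊗_{Aᵉ} Y` killed by `id ⊗ ι` for all
monomorphisms `ι` from `Y` to an injective bimodule. -/
def stableTensor : Submodule k (TensorE k A X Y) where
  carrier := {w | ∀ (I : Type u) [AddCommGroup I] [Module k I] [Module (Env k A) I]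
    [IsScalarTower k (Env k A) I] (ι : Y →ₗ[Env k A] I), Module.Injective (Env k A) I →
    Function.Injective ι → TensorE.map (LinearMap.id : X →ₗ[Env k A] X) ι w = 0}
  zero_mem' := fun _ _ _ _ _ _ _ _ => map_zero _
  add_mem' := fun hv hw I _ _ _ _ ι hI hι => by rw [map_add, hv I ι hI hι, hw I ι hI hι, add_zero]
  smul_mem' := fun c w hw I _ _ _ _ ι hI hι => by rw [map_smul, hw I ι hI hι, smul_zero]

end Stable

/-! ## The products on stable Hochschild (co)homology -/

section StableProducts

variable (T : CompleteResolution k A A)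

/-- `ω : Ω^{i+j} A → Ω^i A` represents `Ω^i g` for `g : Ω^j A → A`. Here `Ω^{i+j} A` is the `i`-th
(co)syzygy of `Ω^j A` with respect to the complete resolution `Σ^{-j} T → Ω^j A`, with differential
`(-1)^j d` and augmentation `π_j`; `G` is a lift of `g` to a chain map `Σ^{-j} T → T`, with
components `G p q`, `p = q + j`, and `ω` is the map with `ω π_{i+j} = π_i G`. -/
def IsOmega (i j : ℤ) (g : T.syzygy j →ₗ[Env k A] A)
    (ω : T.syzygy (i + j) →ₗ[Env k A] T.syzygy i) : Prop :=
  ∃ G : ∀ p q : ℤ, T.complex.X p →ₗ[Env k A] T.complex.X q,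
    (∀ p q : ℤ, q + j = p → dd T.complex q (q - 1) ∘ₗ G p q
      = sgn j • (G (p - 1) (q - 1) ∘ₗ dd T.complex p (p - 1))) ∧
    T.aug ∘ₗ G j 0 = g ∘ₗ T.proj j ∧
    T.proj i ∘ₗ G (i + j) i = ω ∘ₗ T.proj (i + j)

/-- `h = f ∪ g` in stable Hochschild cohomology, i.e. `h = f ∘ Ω^i g`. -/
def IsStableCup (i j : ℤ) (f : StableHom (k := k) (A := A) (T.syzygy i) A)
    (g : StableHom (k := k) (A := A) (T.syzygy j) A)
    (h : StableHom (k := k) (A := A) (T.syzygy (i + j)) A) : Prop :=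
  ∃ (f₀ : T.syzygy i →ₗ[Env k A] A) (g₀ : T.syzygy j →ₗ[Env k A] A)
    (ω : T.syzygy (i + j) →ₗ[Env k A] T.syzygy i),
    Submodule.Quotient.mk f₀ = f ∧ Submodule.Quotient.mk g₀ = g ∧ IsOmega T i j g₀ ω ∧
      h = Submodule.Quotient.mk (f₀ ∘ₗ ω)

variable (M : Type u) [AddCommGroup M] [Module k M] [Module (Env k A) M]
  [IsScalarTower k (Env k A) M] (S : CompleteResolution k A M)

variable {M} in
/-- The relation `w ↔ y` that gives the isomorphism `Ω^n L ⊗ M ≅ L ⊗ Ω^n M` of stable tensor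
products, where `L` is the image of `α : T_i → L`, `Ω^n L = Ω^j A` with `j = i + n` is its (co)syzygy
with respect to the complete resolution `Σ^{-i} T` (with differential `(-1)^i d` and augmentation
`α`, and with the epimorphisms `π_p : T_p → Ω^p A`), and `Ω^n M` is computed from `S`. The elements `w` and `y` are linked by elements `t p q` of
`T_p ⊗ S_q`, `p + q = j`, which are successively lifted along the differentials of the two
resolutions: `t j 0` lies over `w` and `t i n` lies over `y`. -/
def ShiftRel (i n j : ℤ) {L : Type u} [AddCommGroup L] [Module k L] [Module (Env k A) L]
    [IsScalarTower k (Env k A) L] (α : T.complex.X i →ₗ[Env k A] L)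
    (w : TensorE k A (T.syzygy j) M) (y : TensorE k A L (S.syzygy n)) : Prop :=
  ∃ t : ∀ p q : ℤ, TensorE k A (T.complex.X p) (S.complex.X q),
    (∀ p q : ℤ, p + q + 1 = j →
      sgn i • TensorE.map (dd T.complex (p + 1) p) LinearMap.id (t (p + 1) q)
        = TensorE.map LinearMap.id (dd S.complex (q + 1) q) (t p (q + 1))) ∧
    w = TensorE.map (T.proj j) S.aug (t j 0) ∧ y = TensorE.map α (S.proj n) (t i n)

variable {M} in
/-- `z' = f ∩ z` in stable Hochschild homology: `z'` is the image of `z` under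
`Ω^j A ⊗ M ≅ Ω^i A ⊗ Ω^{j-i} M → A ⊗ Ω^{j-i} M ≅ Ω^{j-i} A ⊗ M`, where the middle map is `f ⊗ id`. -/
def IsStableCap (i j : ℤ) (f : StableHom (k := k) (A := A) (T.syzygy i) A)
    (z : stableTensor (k := k) (A := A) (T.syzygy j) M)
    (z' : stableTensor (k := k) (A := A) (T.syzygy (j - i)) M) : Prop :=
  ∃ (f₀ : T.syzygy i →ₗ[Env k A] A)
    (y : stableTensor (k := k) (A := A) (T.syzygy i) (S.syzygy (j - i))),
    Submodule.Quotient.mk f₀ = f ∧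
    ShiftRel T S i (j - i) j (T.proj i) z.1 y.1 ∧
    ShiftRel T S 0 (j - i) (j - i) T.aug z'.1 (TensorE.map f₀ LinearMap.id y.1)

end StableProducts

/-! ## Graded commutative algebras -/

/-- The products `mul i j : H_i ⊗ H_j → H_{i+j}` make `⨁ H_i` an associative graded algebra with
unit `one`, which is graded commutative, `x y = (-1)^{ij} y x`. -/
structure IsGradedCommAlgebra {H : ℤ → Type u} [∀ i, AddCommMonoid (H i)] [∀ i, Module k (H i)]
    (mul : ∀ i j : ℤ, H i →ₗ[k] H j →ₗ[k] H (i + j)) (one : H 0) : Prop where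
  one_mul : ∀ (i : ℤ) (x : H i),
    DirectSum.lof k ℤ H (0 + i) (mul 0 i one x) = DirectSum.lof k ℤ H i x
  mul_one : ∀ (i : ℤ) (x : H i),
    DirectSum.lof k ℤ H (i + 0) (mul i 0 x one) = DirectSum.lof k ℤ H i x
  mul_assoc : ∀ (i j l : ℤ) (x : H i) (y : H j) (z : H l),
    DirectSum.lof k ℤ H (i + j + l) (mul (i + j) l (mul i j x y) z)
      = DirectSum.lof k ℤ H (i + (j + l)) (mul i (j + l) x (mul j l y z))
  mul_comm : ∀ (i j : ℤ) (x : H i) (y : H j),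
    DirectSum.lof k ℤ H (i + j) (mul i j x y)
      = (sgn (i * j) : k) • DirectSum.lof k ℤ H (j + i) (mul j i y x)

end

end TateHochschild

open TateHochschild

set_option linter.unusedSectionVars false

namespace TateHochschild

noncomputable section

variable {k A : Type u} [Field k] [Ring A] [Algebra k A]

/-! ## Tensor products over the enveloping algebra -/

section TensorE

variable {X Y X' Y' X'' Y'' : Type u}
  [AddCommGroup X] [Module k X] [Module (Env k A) X] [IsScalarTower k (Env k A) X]
  [AddCommGroup Y] [Module k Y] [Module (Env k A) Y] [IsScalarTower k (Env k A) Y]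
  [AddCommGroup X'] [Module k X'] [Module (Env k A) X'] [IsScalarTower k (Env k A) X']
  [AddCommGroup Y'] [Module k Y'] [Module (Env k A) Y'] [IsScalarTower k (Env k A) Y']
  [AddCommGroup X''] [Module k X''] [Module (Env k A) X''] [IsScalarTower k (Env k A) X'']
  [AddCommGroup Y''] [Module k Y''] [Module (Env k A) Y''] [IsScalarTower k (Env k A) Y'']

/-! All four products are governed by one construction. A cocycle `v : T_j → A` gives the maps
`rightLift Δ v`, that is `(1 ⊗̂ v) Δ : T_{q+j} → T_q` with the sign `(-1)^{qj}`; the Leibniz rule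
for `Δ` makes them a chain map of degree `j`. At the level of (co)chains `u ⌣ v` is `u ∘ rightLift
v` and `u ⌢ z` is `(rightLift u ⊗ 1) z`. On the other side `∪` is composition with some chain map
that lifts `g`. So the comparison rests on the uniqueness of lifts.

Uniqueness is `IsDegMap.exists_proj_comp`: if `ε G_0` is a coboundary for a chain map `G`, then
every `π_q G` factors through the differential, so that composition with `G` sends cocycles to
coboundaries. The induction runs upwards by projectivity and downwards by exactness of the dual
complex. To apply it, `ε ∘ rightLift v` must be cohomologous to `v`. It equals `v ∘ leftLift ε`,
where `leftLift ε = (ε ⊗̂ 1) Δ` is a chain map of degree `0` over the identity of `A`, hence acts as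
the identity on cohomology. The algebra laws follow without any coassociativity of `Δ`: a composite
of lifts of `v` and `w` lifts `v ⌣ w`, and `leftLift u` and `rightLift u` both lift `u`, which gives
graded commutativity with its sign.

`Φ` is bijective because every cocycle factors through `π_i`, and `f π_i` is a coboundary exactly
when `f` factors through a projective (`projHoms_eq_ker`).

For homology the Frobenius hypothesis enters: a finitely generated `M` embeds in a finitely
generated bimodule `I` that is both projective and injective. Since finitely generated projectives
are flat, an element of `Ω^j A ⊗ M` is stable if and only if it dies in `T_{j-1} ⊗ M`
(`mem_stableTensor_iff`). Its preimages in `T_j ⊗ M` are then cycles, unique up to boundaries by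
right exactness; this is `Ψ`.

The dimension shifts in `∩` are zigzags `t_{p,q} ∈ T_p ⊗ S_q`. The lift of `f`, applied in the first
factor, carries a zigzag that starts over `z` to one that starts over `f ⌢ z` and ends over `(f ⊗ 1)
y`. A zigzag whose `A ⊗ Ω^n M` end vanishes has a boundary at the other end
(`IsLinked.exists_eq_add`), so this zigzag determines the answer.

Both stable products are obtained by transport along `Φ` and `Ψ`, and the defining relations are
shown to be their graphs. This yields well-definedness, bilinearity and independence of choices at
once. -/

theorem TensorE.hom_ext {Z : Type u} [AddCommGroup Z] [Module k Z]
    {f g : TensorE k A X Y →ₗ[k] Z}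
    (h : ∀ x y, f (TensorE.tmul k A x y) = g (TensorE.tmul k A x y)) : f = g := by
  ext t
  induction t using TensorE.induction with
  | h0 => simp
  | h1 x y => exact h x y
  | h2 s t hs ht => simp [hs, ht]

theorem TensorE.map_map (f : X →ₗ[Env k A] X') (g : Y →ₗ[Env k A] Y')
    (f' : X' →ₗ[Env k A] X'') (g' : Y' →ₗ[Env k A] Y'') (t : TensorE k A X Y) :
    TensorE.map f' g' (TensorE.map f g t) = TensorE.map (f' ∘ₗ f) (g' ∘ₗ g) t :=
  LinearMap.congr_fun (f := TensorE.map f' g' ∘ₗ TensorE.map f g)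
    (TensorE.hom_ext fun x y => by simp [TensorE.map_tmul]) t

theorem TensorE.map_add_left (f f' : X →ₗ[Env k A] X') (g : Y →ₗ[Env k A] Y')
    (t : TensorE k A X Y) :
    TensorE.map (f + f') g t = TensorE.map f g t + TensorE.map f' g t :=
  LinearMap.congr_fun (g := TensorE.map f g + TensorE.map f' g) (TensorE.hom_ext fun x y => by
    simp only [TensorE.map_tmul, LinearMap.add_apply]
    exact LinearMap.map_add₂ (TensorE.mk₂ k A X' Y') (f x) (f' x) (g y)) t

theorem TensorE.map_zero_left (g : Y →ₗ[Env k A] Y') (t : TensorE k A X Y) :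
    TensorE.map (0 : X →ₗ[Env k A] X') g t = 0 := by
  have := TensorE.map_add_left (0 : X →ₗ[Env k A] X') 0 g t
  simpa using this

theorem TensorE.map_zero_right (f : X →ₗ[Env k A] X') (t : TensorE k A X Y) :
    TensorE.map f (0 : Y →ₗ[Env k A] Y') t = 0 :=
  LinearMap.congr_fun (g := 0) (TensorE.hom_ext fun x y => by
    simpa [TensorE.map_tmul] using map_zero (TensorE.mk₂ k A X' Y' (f x))) t

theorem TensorE.map_neg_left (f : X →ₗ[Env k A] X') (g : Y →ₗ[Env k A] Y')
    (t : TensorE k A X Y) : TensorE.map (-f) g t = -TensorE.map f g t := by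
  rw [eq_neg_iff_add_eq_zero, ← TensorE.map_add_left, neg_add_cancel, TensorE.map_zero_left]

theorem TensorE.map_sub_left (f f' : X →ₗ[Env k A] X') (g : Y →ₗ[Env k A] Y')
    (t : TensorE k A X Y) :
    TensorE.map (f - f') g t = TensorE.map f g t - TensorE.map f' g t := by
  rw [sub_eq_add_neg, TensorE.map_add_left, TensorE.map_neg_left, ← sub_eq_add_neg]

theorem sgn_eq_or (n : ℤ) : sgn n = 1 ∨ sgn n = -1 := by
  rcases Int.units_eq_one_or (Int.negOnePow n) with h | h <;> simp [sgn, h]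

theorem TensorE.map_sgn_left (n : ℤ) (f : X →ₗ[Env k A] X') (g : Y →ₗ[Env k A] Y')
    (t : TensorE k A X Y) : TensorE.map (sgn n • f) g t = sgn n • TensorE.map f g t := by
  rcases sgn_eq_or n with h | h <;> simp [h, TensorE.map_neg_left]

variable (k A X Y) in
/-- The symmetry of the tensor product over the enveloping algebra. -/
def TensorE.swap : TensorE k A X Y →ₗ[k] TensorE k A Y X :=
  TensorE.lift (TensorE.mk₂ k A Y X).flip fun a b x y => by
    simp only [LinearMap.flip_apply, TensorE.mk₂_apply]
    exact (TensorE.balanced b a y x).symm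

theorem TensorE.swap_tmul (x : X) (y : Y) :
    TensorE.swap k A X Y (TensorE.tmul k A x y) = TensorE.tmul k A y x :=
  TensorE.lift_tmul _ _ x y

theorem TensorE.swap_swap (t : TensorE k A X Y) :
    TensorE.swap k A Y X (TensorE.swap k A X Y t) = t :=
  LinearMap.congr_fun (f := TensorE.swap k A Y X ∘ₗ TensorE.swap k A X Y) (g := LinearMap.id)
    (TensorE.hom_ext fun x y => by simp [TensorE.swap_tmul]) t

theorem TensorE.swap_map (f : X →ₗ[Env k A] X') (g : Y →ₗ[Env k A] Y') (t : TensorE k A X Y) :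
    TensorE.swap k A X' Y' (TensorE.map f g t) = TensorE.map g f (TensorE.swap k A X Y t) :=
  LinearMap.congr_fun (f := TensorE.swap k A X' Y' ∘ₗ TensorE.map f g)
    (g := TensorE.map g f ∘ₗ TensorE.swap k A X Y)
    (TensorE.hom_ext fun x y => by simp [TensorE.swap_tmul, TensorE.map_tmul]) t

theorem TensorE.map_surjective {f : X →ₗ[Env k A] X'} {g : Y →ₗ[Env k A] Y'}
    (hf : Function.Surjective f) (hg : Function.Surjective g) :
    Function.Surjective (TensorE.map f g) := by
  intro t
  induction t using TensorE.induction with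
  | h0 => exact ⟨0, map_zero _⟩
  | h1 x y =>
    obtain ⟨x, rfl⟩ := hf x
    obtain ⟨y, rfl⟩ := hg y
    exact ⟨_, TensorE.map_tmul f g x y⟩
  | h2 s t hs ht =>
    obtain ⟨s, rfl⟩ := hs
    obtain ⟨t, rfl⟩ := ht
    exact ⟨s + t, map_add _ _ _⟩

theorem TensorE.map_proj (f : X →ₗ[Env k A] X') (g : Y →ₗ[Env k A] Y') (t : X ⊗[k] Y) :
    TensorE.map f g (TensorE.proj k A X Y t)
      = TensorE.proj k A X' Y' (TensorProduct.map (f.restrictScalars k) (g.restrictScalars k) t) :=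
  LinearMap.congr_fun (f := TensorE.map f g ∘ₗ TensorE.proj k A X Y)
    (g := TensorE.proj k A X' Y' ∘ₗ
      TensorProduct.map (f.restrictScalars k) (g.restrictScalars k))
    (TensorProduct.ext' fun x y => TensorE.map_tmul f g x y) t

/-- The relations over the target of a pair of epimorphisms lift to relations over the source. -/
theorem relE_le_map {f : X →ₗ[Env k A] X'} {g : Y →ₗ[Env k A] Y'}
    (hf : Function.Surjective f) (hg : Function.Surjective g) :
    relE k A X' Y' ≤ (relE k A X Y).map
      (TensorProduct.map (f.restrictScalars k) (g.restrictScalars k)) := by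
  rw [relE, Submodule.span_le]
  rintro _ ⟨a, b, x, y, rfl⟩
  obtain ⟨x, rfl⟩ := hf x
  obtain ⟨y, rfl⟩ := hg y
  exact ⟨_, Submodule.subset_span ⟨a, b, x, y, rfl⟩, by simp⟩

/-- The kernel of the tensor product of two epimorphisms. -/
theorem TensorE.exists_of_map_eq_zero {f : X' →ₗ[Env k A] X''} {g : Y' →ₗ[Env k A] Y''}
    {f' : X →ₗ[Env k A] X'} {g' : Y →ₗ[Env k A] Y'}
    (hf : Function.Surjective f) (hg : Function.Surjective g)
    (hf' : Function.Exact f' f) (hg' : Function.Exact g' g)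
    {t : TensorE k A X' Y'} (ht : TensorE.map f g t = 0) :
    ∃ (a : TensorE k A X Y') (b : TensorE k A X' Y),
      t = TensorE.map f' LinearMap.id a + TensorE.map LinearMap.id g' b := by
  obtain ⟨s, rfl⟩ := (relE k A X' Y').mkQ_surjective t
  change TensorE.map f g (TensorE.proj k A X' Y' s) = 0 at ht
  rw [TensorE.map_proj] at ht
  -- The vanishing over `Aᵉ` is a relation over `k` modulo `relE`. It lifts to a relation `r`
  -- upstairs, and `s - r` lies in the kernel of a tensor product of epimorphisms over `k`, which is
  -- known.
  obtain ⟨r, hr, hrs⟩ := relE_le_map hf hg ((Submodule.Quotient.mk_eq_zero _).1 ht)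
  have hker : s - r ∈ LinearMap.ker
      (TensorProduct.map (f.restrictScalars k) (g.restrictScalars k)) := by
    rw [LinearMap.mem_ker, map_sub, hrs, sub_self]
  rw [TensorProduct.map_ker (f := f'.restrictScalars k) (g := f.restrictScalars k)
    (f' := g'.restrictScalars k) (g' := g.restrictScalars k) hf' hf hg' hg] at hker
  obtain ⟨_, ⟨b, rfl⟩, _, ⟨a, rfl⟩, hab⟩ := Submodule.mem_sup.1 hker
  refine ⟨TensorE.proj k A _ _ a, TensorE.proj k A _ _ b, ?_⟩
  rw [TensorE.map_proj, TensorE.map_proj]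
  have hr0 : TensorE.proj k A X' Y' r = 0 := (Submodule.Quotient.mk_eq_zero _).2 hr
  change TensorE.proj k A X' Y' s = _
  rw [← sub_zero (TensorE.proj k A X' Y' s), ← hr0, ← map_sub, ← hab, map_add, add_comm]
  rfl

end TensorE

/-! ## Finitely generated projective bimodules -/

section Flat

variable {X Y Y' Y'' : Type u}
  [AddCommGroup X] [Module k X] [Module (Env k A) X] [IsScalarTower k (Env k A) X]
  [AddCommGroup Y] [Module k Y] [Module (Env k A) Y] [IsScalarTower k (Env k A) Y]
  [AddCommGroup Y'] [Module k Y'] [Module (Env k A) Y'] [IsScalarTower k (Env k A) Y']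
  [AddCommGroup Y''] [Module k Y''] [Module (Env k A) Y''] [IsScalarTower k (Env k A) Y'']

/-- A finitely generated projective module has a finite dual basis. -/
theorem exists_dual_basis (R N : Type*) [Ring R] [AddCommGroup N] [Module R N]
    [Module.Finite R N] [Module.Projective R N] :
    ∃ (n : ℕ) (x : Fin n → N) (φ : Fin n → N →ₗ[R] R), ∀ y, ∑ i, φ i y • x i = y := by
  obtain ⟨n, f, hf⟩ := Module.Finite.exists_fin' R N
  obtain ⟨s, hs⟩ := Module.projective_lifting_property f LinearMap.id hf
  refine ⟨n, fun i => f (Pi.single i 1), fun i => LinearMap.proj i ∘ₗ s, fun y => ?_⟩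
  conv_rhs => rw [← LinearMap.id_apply (R := R) y, ← hs, LinearMap.comp_apply,
    ← Finset.univ_sum_single (s y), map_sum]
  refine Finset.sum_congr rfl fun i _ => ?_
  rw [← map_smul]
  congr 1
  ext j
  by_cases h : j = i
  · subst h; simp
  · simp [h]

variable (k A Y) in
/-- The right action of the enveloping algebra on a bimodule, `a ⊗ b° ↦ (y ↦ b y a)`. -/
def swapAct : Env k A →ₗ[k] Y →ₗ[k] Y :=
  TensorProduct.lift (LinearMap.mk₂ k (fun (a : A) (b : Aᵐᵒᵖ) => ofAct k Y b.unop a)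
    (fun a a' b => by ext; simp [Env.of_add, add_smul])
    (fun c a b => by ext; simp [Env.of_smul])
    (fun a b b' => by ext; simp [Env.add_of, add_smul])
    (fun c a b => by ext; simp [Env.smul_of]))

theorem swapAct_of (a b : A) (y : Y) : swapAct k A Y (Env.of k a b) y = Env.of k b a • y :=
  rfl

theorem tmul_swapAct (e : Env k A) (x : X) (y : Y) :
    TensorE.tmul k A x (swapAct k A Y e y) = TensorE.tmul k A (e • x) y := by
  induction e using Env.induction with
  | h0 =>
    rw [map_zero, zero_smul, LinearMap.zero_apply, ← TensorE.mk₂_apply, ← TensorE.mk₂_apply,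
      map_zero, map_zero, LinearMap.zero_apply]
  | h1 a b => rw [swapAct_of, TensorE.balanced]
  | h2 e e' he he' =>
    rw [map_add, add_smul, LinearMap.add_apply, ← TensorE.mk₂_apply, ← TensorE.mk₂_apply,
      map_add, map_add, LinearMap.add_apply]
    exact congrArg₂ _ he he'

/-- The right action reverses products; this is what makes `evalLeft` balanced. -/
theorem swapAct_of_mul (a b : A) (e : Env k A) (y : Y) :
    swapAct k A Y (Env.of k b a * e) y = swapAct k A Y e (Env.of k a b • y) := by
  induction e using Env.induction with
  | h0 => simp
  | h1 c d => rw [Env.of_mul, swapAct_of, swapAct_of, ← mul_smul, Env.of_mul]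
  | h2 e e' he he' => rw [mul_add, map_add, map_add, LinearMap.add_apply, LinearMap.add_apply,
      he, he']

theorem swapAct_comm (g : Y →ₗ[Env k A] Y') (e : Env k A) (y : Y) :
    g (swapAct k A Y e y) = swapAct k A Y' e (g y) := by
  induction e using Env.induction with
  | h0 => simp
  | h1 c d => rw [swapAct_of, swapAct_of, map_smul]
  | h2 e e' he he' => rw [map_add, map_add, LinearMap.add_apply, LinearMap.add_apply, map_add,
      he, he']

variable (Y) in
/-- The map `X ⊗ Y → Y` induced by a linear form on `X`. -/
def evalLeft (φ : X →ₗ[Env k A] Env k A) : TensorE k A X Y →ₗ[k] Y :=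
  TensorE.lift (swapAct k A Y ∘ₗ φ.restrictScalars k) fun a b x y => by
    simp only [LinearMap.comp_apply, LinearMap.restrictScalars_apply, map_smul, smul_eq_mul]
    exact swapAct_of_mul a b _ y

theorem evalLeft_tmul (φ : X →ₗ[Env k A] Env k A) (x : X) (y : Y) :
    evalLeft Y φ (TensorE.tmul k A x y) = swapAct k A Y (φ x) y :=
  TensorE.lift_tmul _ _ x y

theorem evalLeft_map (φ : X →ₗ[Env k A] Env k A) (g : Y →ₗ[Env k A] Y')
    (t : TensorE k A X Y) :
    evalLeft Y' φ (TensorE.map LinearMap.id g t) = g (evalLeft Y φ t) :=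
  LinearMap.congr_fun (f := evalLeft Y' φ ∘ₗ TensorE.map LinearMap.id g)
    (g := g.restrictScalars k ∘ₗ evalLeft Y φ)
    (TensorE.hom_ext fun x y => by
      simp [evalLeft_tmul, TensorE.map_tmul, swapAct_comm]) t

/-- A dual basis exhibits `X ⊗ Y`, naturally in `Y`, as a direct summand of `Y^n`. Exactness in `Y`
can therefore be checked coordinate by coordinate. -/
theorem sum_tmul_evalLeft {n : ℕ} {x : Fin n → X} {φ : Fin n → X →ₗ[Env k A] Env k A}
    (h : ∀ y, ∑ i, φ i y • x i = y) (t : TensorE k A X Y) :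
    ∑ i, TensorE.tmul k A (x i) (evalLeft Y (φ i) t) = t := by
  have : ∑ i, TensorE.mk₂ k A X Y (x i) ∘ₗ evalLeft Y (φ i) = LinearMap.id :=
    TensorE.hom_ext fun z y => by
      rw [LinearMap.sum_apply, LinearMap.id_apply, ← TensorE.mk₂_apply]
      nth_rw 2 [← h z]
      rw [map_sum, LinearMap.sum_apply]
      refine Finset.sum_congr rfl fun i _ => ?_
      rw [LinearMap.comp_apply, TensorE.mk₂_apply, TensorE.mk₂_apply, TensorE.mk₂_apply,
        evalLeft_tmul, tmul_swapAct]
  simpa using LinearMap.congr_fun this t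

/-- Finitely generated projective bimodules are flat. -/
theorem TensorE.exists_map_id_eq [Module.Finite (Env k A) X] [Module.Projective (Env k A) X]
    {f : Y →ₗ[Env k A] Y'} {g : Y' →ₗ[Env k A] Y''} (h : Function.Exact f g)
    {t : TensorE k A X Y'} (ht : TensorE.map LinearMap.id g t = 0) :
    ∃ s : TensorE k A X Y, TensorE.map LinearMap.id f s = t := by
  obtain ⟨n, x, φ, hφ⟩ := exists_dual_basis (Env k A) X
  have (i : Fin n) : ∃ y, f y = evalLeft Y' (φ i) t :=
    (h _).1 (by rw [← evalLeft_map, ht, map_zero])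
  choose y hy using this
  refine ⟨∑ i, TensorE.tmul k A (x i) (y i), ?_⟩
  rw [map_sum, ← sum_tmul_evalLeft hφ t]
  exact Finset.sum_congr rfl fun i _ => by rw [TensorE.map_tmul, hy, LinearMap.id_apply]

theorem TensorE.exists_map_id_eq' [Module.Finite (Env k A) X] [Module.Projective (Env k A) X]
    {f : Y →ₗ[Env k A] Y'} {g : Y' →ₗ[Env k A] Y''} (h : Function.Exact f g)
    {t : TensorE k A Y' X} (ht : TensorE.map g LinearMap.id t = 0) :
    ∃ s : TensorE k A Y X, TensorE.map f LinearMap.id s = t := by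
  obtain ⟨s, hs⟩ := TensorE.exists_map_id_eq (X := X) h (t := TensorE.swap k A Y' X t)
    (by rw [← TensorE.swap_map, ht, map_zero])
  exact ⟨TensorE.swap k A X Y s, by rw [← TensorE.swap_map, hs, TensorE.swap_swap]⟩

theorem TensorE.map_id_injective [Module.Finite (Env k A) X] [Module.Projective (Env k A) X]
    {g : Y →ₗ[Env k A] Y'} (hg : Function.Injective g) :
    Function.Injective (TensorE.map (LinearMap.id : X →ₗ[Env k A] X) g) := by
  rw [injective_iff_map_eq_zero]
  intro t ht
  -- Injectivity of `g` is exactness of `Y → Y → Y'` with first map zero.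
  obtain ⟨s, rfl⟩ := TensorE.exists_map_id_eq (X := X) (f := (0 : Y →ₗ[Env k A] Y))
    (fun y => ⟨fun hy => ⟨0, (hg (hy.trans (map_zero g).symm)).symm⟩, by
      rintro ⟨_, rfl⟩; exact map_zero g⟩) ht
  exact TensorE.map_zero_right _ s

theorem TensorE.map_id_injective' [Module.Finite (Env k A) X] [Module.Projective (Env k A) X]
    {g : Y →ₗ[Env k A] Y'} (hg : Function.Injective g) :
    Function.Injective (TensorE.map g (LinearMap.id : X →ₗ[Env k A] X)) := by
  intro s t h
  have := TensorE.map_id_injective (X := X) hg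
    (((TensorE.swap_map _ _ s).symm.trans (congrArg _ h)).trans (TensorE.swap_map _ _ t))
  rw [← TensorE.swap_swap s, this, TensorE.swap_swap]

end Flat

/-! ## Injective bimodules over a Frobenius algebra -/

/-- A Frobenius system: a linear form `tr` with a pair of dual bases `a`, `b`. -/
structure FrobeniusSystem (k E : Type*) [Field k] [Ring E] [Algebra k E] where
  ι : Type
  [fintype : Fintype ι]
  a : ι → E
  b : ι → E
  tr : E →ₗ[k] k
  sum_left : ∀ e, ∑ i, tr (b i * e) • a i = e
  sum_right : ∀ e, ∑ i, tr (e * a i) • b i = e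

attribute [instance] FrobeniusSystem.fintype

/-- With a basis `v`, its `B`-dual basis `w` and `tr x = B(x, 1)`, associativity gives `B(x, y) =
tr(xy)`; the two sum formulas are the expansions in `v` and in `w`. -/
theorem exists_frobeniusSystem [Module.Finite k A] (hA : IsFrobenius k A) :
    Nonempty (FrobeniusSystem k A) := by
  obtain ⟨B, hB, hassoc⟩ := hA
  let v := Module.finBasis k A
  let w := B.dualBasis hB v
  have htr (x y : A) : B (x * y) 1 = B x y := by rw [hassoc, mul_one]
  have key : ∀ i j, B (w i) (v j) = if j = i then 1 else 0 :=
    fun i j => B.apply_dualBasis_left hB v i j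
  refine ⟨⟨Fin (Module.finrank k A), v, w, LinearMap.flip B 1, fun e => ?_, fun e => ?_⟩⟩
  · simp only [LinearMap.flip_apply, htr]
    conv_rhs => rw [← v.sum_repr e]
    refine Finset.sum_congr rfl fun i _ => ?_
    have := congrArg (B (w i)) (v.sum_repr e)
    rw [map_sum] at this
    simp only [map_smul, key, smul_eq_mul, mul_ite, mul_one, mul_zero, Finset.sum_ite_eq',
      Finset.mem_univ, if_true] at this
    rw [this]
  · simp only [LinearMap.flip_apply, htr]
    conv_rhs => rw [← w.sum_repr e]
    refine Finset.sum_congr rfl fun i _ => ?_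
    have := congrArg (fun x => B x (v i)) (w.sum_repr e)
    rw [LinearMap.map_sum₂] at this
    simp only [LinearMap.map_smul₂, key, smul_eq_mul, mul_ite, mul_one, mul_zero,
      Finset.sum_ite_eq, Finset.mem_univ, if_true] at this
    rw [this]

variable (k A) in
/-- The bilinear map `(a, b) ↦ a ⊗ b°`. -/
def Env.ofBilin : A →ₗ[k] A →ₗ[k] Env k A :=
  LinearMap.mk₂ k (Env.of k) Env.add_of Env.smul_of Env.of_add fun c a b => Env.of_smul c a b

/-- The linear form on the enveloping algebra induced by a linear form on the algebra. -/
def envTrace (f : A →ₗ[k] k) : Env k A →ₗ[k] k :=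
  TensorProduct.lift (LinearMap.mk₂ k (fun (a : A) (b : Aᵐᵒᵖ) => f a * f b.unop)
    (fun a a' b => by simp [add_mul])
    (fun c a b => by simp [mul_assoc])
    (fun a b b' => by simp [mul_add])
    (fun c a b => by simp [mul_left_comm]))

theorem envTrace_of (f : A →ₗ[k] k) (a b : A) : envTrace f (Env.of k a b) = f a * f b := rfl

theorem Env.sum_smul_of {ι : Type} [Fintype ι] (c d : ι → k) (a b : ι → A) :
    ∑ s : ι × ι, (c s.1 * d s.2) • Env.of k (a s.1) (b s.2)
      = Env.of k (∑ i, c i • a i) (∑ i, d i • b i) := by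
  change _ = Env.ofBilin k A _ _
  rw [Fintype.sum_prod_type, LinearMap.map_sum₂]
  refine Finset.sum_congr rfl fun i _ => ?_
  rw [map_sum]
  refine Finset.sum_congr rfl fun j _ => ?_
  rw [map_smul, map_smul, LinearMap.smul_apply, smul_smul, mul_comm]
  rfl

/-- The enveloping algebra of a Frobenius algebra is Frobenius. -/
def FrobeniusSystem.env (F : FrobeniusSystem k A) : FrobeniusSystem k (Env k A) where
  ι := F.ι × F.ι
  -- Multiplication is reversed in the second tensor factor, so the two dual bases trade places
  -- there.
  a s := Env.of k (F.a s.1) (F.b s.2)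
  b s := Env.of k (F.b s.1) (F.a s.2)
  tr := envTrace F.tr
  sum_left e := by
    induction e using Env.induction with
    | h0 => simp
    | h1 x y =>
      conv_rhs => rw [← F.sum_left x, ← F.sum_right y]
      simp only [Env.of_mul, envTrace_of]
      exact Env.sum_smul_of (fun i => F.tr (F.b i * x)) (fun i => F.tr (y * F.a i)) F.a F.b
    | h2 e e' he he' => simp only [mul_add, map_add, add_smul, Finset.sum_add_distrib, he, he']
  sum_right e := by
    induction e using Env.induction with
    | h0 => simp
    | h1 x y =>
      conv_rhs => rw [← F.sum_right x, ← F.sum_left y]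
      simp only [Env.of_mul, envTrace_of]
      exact Env.sum_smul_of (fun i => F.tr (x * F.a i)) (fun i => F.tr (F.b i * y)) F.b F.a
    | h2 e e' he he' => simp only [add_mul, map_add, add_smul, Finset.sum_add_distrib, he, he']

/-! ### Free modules over a Frobenius algebra are coinduced, hence injective -/

section FreeCover

variable {E : Type u} [Ring E] [Algebra k E] (F : FrobeniusSystem k E)
  {X : Type u} [AddCommGroup X] [Module k X] [Module E X] [IsScalarTower k E X]
  {V : Type u} [AddCommGroup V] [Module k V]

/-- The `E`-linear map `x ↦ ∑ a_i ⊗ f (b_i x)` to a free module attached to a linear map `f`. -/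
def FrobeniusSystem.coind (f : X →ₗ[k] V) : X →ₗ[E] E ⊗[k] V where
  toFun x := ∑ i, F.a i ⊗ₜ[k] f (F.b i • x)
  map_add' x y := by
    simp only [smul_add, map_add, TensorProduct.tmul_add, Finset.sum_add_distrib]
  map_smul' e x := by
    -- The element `∑ a_i ⊗ b_i` satisfies `∑ a_i ⊗ b_i e = ∑ e a_j ⊗ b_j`: the expansions of `b_i
    -- e` in the `b_j` and of `e a_j` in the `a_i` have the same coefficients `tr(b_i e a_j)`.
    have h (i : F.ι) : F.b i * e = ∑ j, F.tr (F.b i * e * F.a j) • F.b j :=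
      (F.sum_right _).symm
    have h' (j : F.ι) : e * F.a j = ∑ i, F.tr (F.b i * (e * F.a j)) • F.a i :=
      (F.sum_left _).symm
    simp only [RingHom.id_apply, Finset.smul_sum, TensorProduct.smul_tmul', smul_eq_mul]
    calc ∑ i, F.a i ⊗ₜ[k] f (F.b i • e • x)
        = ∑ i, ∑ j, F.tr (F.b i * e * F.a j) • F.a i ⊗ₜ[k] f (F.b j • x) := by
          refine Finset.sum_congr rfl fun i _ => ?_
          conv_lhs => rw [← mul_smul, h i, Finset.sum_smul, map_sum, TensorProduct.tmul_sum]
          simp only [smul_assoc, map_smul, TensorProduct.tmul_smul]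
      _ = ∑ j, ∑ i, F.tr (F.b i * e * F.a j) • F.a i ⊗ₜ[k] f (F.b j • x) := Finset.sum_comm
      _ = _ := by
          refine Finset.sum_congr rfl fun j _ => ?_
          rw [h' j, TensorProduct.sum_tmul]
          simp only [TensorProduct.smul_tmul', mul_assoc]

theorem FrobeniusSystem.coind_apply (f : X →ₗ[k] V) (x : X) :
    F.coind f x = ∑ i, F.a i ⊗ₜ[k] f (F.b i • x) := rfl

variable (V) in
/-- The counit `E ⊗ V → V`, `e ⊗ v ↦ tr e • v`. -/
def FrobeniusSystem.counit : E ⊗[k] V →ₗ[k] V :=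
  TensorProduct.lift (LinearMap.lsmul k V ∘ₗ F.tr)

theorem FrobeniusSystem.counit_tmul (e : E) (v : V) : F.counit V (e ⊗ₜ v) = F.tr e • v := rfl

/-- An `E`-linear map into `E ⊗ V` is recovered from its `k`-linear composite with the counit.
Extension problems into `E ⊗ V` thus become extension problems over the field `k`. -/
theorem FrobeniusSystem.coind_counit (g : X →ₗ[E] E ⊗[k] V) :
    F.coind (F.counit V ∘ₗ g.restrictScalars k) = g := by
  ext x
  simp only [F.coind_apply, LinearMap.comp_apply, LinearMap.restrictScalars_apply, map_smul]
  induction g x with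
  | zero => simp
  | tmul e v =>
    simp only [TensorProduct.smul_tmul', F.counit_tmul, smul_eq_mul, TensorProduct.tmul_smul]
    conv_rhs => rw [← F.sum_left e, TensorProduct.sum_tmul]
  | add s t hs ht =>
    simp only [smul_add, map_add, TensorProduct.tmul_add, Finset.sum_add_distrib, hs, ht]

/-- The counit is a `k`-linear retraction, because `∑ tr(a_i) b_i = 1`. -/
theorem FrobeniusSystem.coind_id_injective :
    Function.Injective (F.coind (LinearMap.id : X →ₗ[k] X)) := by
  have h : ∀ x : X, F.counit X (F.coind LinearMap.id x) = x := fun x => by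
    rw [F.coind_apply, map_sum]
    simp only [F.counit_tmul, LinearMap.id_apply, ← smul_assoc, ← Finset.sum_smul]
    simpa using congrArg (· • x) (F.sum_right 1)
  exact Function.LeftInverse.injective h

/-- Free modules over a Frobenius algebra are injective. -/
theorem FrobeniusSystem.injective (F : FrobeniusSystem k E) : Module.Injective E (E ⊗[k] V) where
  out X Y _ _ _ _ f hf g := by
    let _ : Module k X := Module.compHom X (algebraMap k E)
    let _ : Module k Y := Module.compHom Y (algebraMap k E)
    have : IsScalarTower k E X := IsScalarTower.of_algebraMap_smul fun _ _ => rfl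
    have : IsScalarTower k E Y := IsScalarTower.of_algebraMap_smul fun _ _ => rfl
    -- Over `k` the monomorphism `f` splits. The counit composite of `g` is extended along the
    -- splitting `r`, and coinduction makes the extension `E`-linear again.
    obtain ⟨r, hr⟩ := LinearMap.exists_leftInverse_of_injective (f.restrictScalars k)
      (LinearMap.ker_eq_bot.2 hf)
    refine ⟨F.coind (F.counit V ∘ₗ g.restrictScalars k ∘ₗ r), fun x => ?_⟩
    conv_rhs => rw [← F.coind_counit g]
    have hr' (x : X) : r (f x) = x := LinearMap.congr_fun hr x
    simp only [F.coind_apply, LinearMap.comp_apply, LinearMap.restrictScalars_apply,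
      ← map_smul f, hr']

end FreeCover

/-- A finitely generated bimodule over a Frobenius algebra embeds in a finitely generated bimodule
that is both projective and injective. -/
theorem exists_injective_hull [Module.Finite k A] (hA : IsFrobenius k A) (N : Type u)
    [AddCommGroup N] [Module k N] [Module (Env k A) N] [IsScalarTower k (Env k A) N]
    [Module.Finite (Env k A) N] :
    ∃ (I : Type u) (_ : AddCommGroup I) (_ : Module k I) (_ : Module (Env k A) I)
      (_ : IsScalarTower k (Env k A) I) (ι : N →ₗ[Env k A] I),
      Module.Finite (Env k A) I ∧ Module.Projective (Env k A) I ∧ Module.Injective (Env k A) I ∧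
        Function.Injective ι := by
  obtain ⟨F⟩ := exists_frobeniusSystem hA
  have : Module.Finite k (Env k A) := inferInstanceAs (Module.Finite k (A ⊗[k] Aᵐᵒᵖ))
  have : Module.Finite k N := Module.Finite.trans (Env k A) N
  refine ⟨Env k A ⊗[k] N, inferInstance, inferInstance, inferInstance, inferInstance,
    F.env.coind LinearMap.id, ?_, ?_, F.env.injective, F.env.coind_id_injective⟩
  · infer_instance
  · infer_instance

/-! ## Maps into and out of a complete resolution -/

theorem sgn_add (m n : ℤ) : sgn (m + n) = sgn m * sgn n := by
  simp [sgn, Int.negOnePow_add]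

theorem sgn_zero : sgn 0 = 1 := by
  simp [sgn]

theorem sgn_smul_sgn_smul {V : Type*} [AddCommGroup V] (n : ℤ) (v : V) :
    sgn n • sgn n • v = v := by
  rw [smul_smul, sgn_mul_self, one_smul]

/-- Two-sided induction phrased with `q - 1`, the target degree of the differential on `T_q`. -/
theorem int_induction {P : ℤ → Prop} (h0 : P 0) (hup : ∀ q, P (q - 1) → P q)
    (hdown : ∀ q, P q → P (q - 1)) (q : ℤ) : P q := by
  induction q using Int.induction_on with
  | zero => exact h0
  | succ n ih => exact hup _ (by rwa [add_sub_cancel_right])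
  | pred n ih => exact hdown _ ih

/-- A map that vanishes on the kernel of an epimorphism factors through it. -/
theorem exists_factor {R X Y N : Type*} [Ring R] [AddCommGroup X] [Module R X] [AddCommGroup Y]
    [Module R Y] [AddCommGroup N] [Module R N] {π : X →ₗ[R] Y} (hπ : Function.Surjective π)
    {φ : X →ₗ[R] N} (h : ∀ x, π x = 0 → φ x = 0) : ∃ f : Y →ₗ[R] N, φ = f ∘ₗ π := by
  refine ⟨(LinearMap.ker π).liftQ φ h ∘ₗ (π.quotKerEquivOfSurjective hπ).symm.toLinearMap, ?_⟩
  ext x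
  have : (π.quotKerEquivOfSurjective hπ).symm (π x) = (LinearMap.ker π).mkQ x :=
    (LinearEquiv.symm_apply_eq _).2 rfl
  simp only [LinearMap.comp_apply, LinearEquiv.coe_coe, this]
  rfl

namespace CompleteResolution

section General

variable {M : Type u} [AddCommGroup M] [Module (Env k A) M] (T : CompleteResolution k A M)

instance (i : ℤ) : Module.Finite (Env k A) (T.complex.X i) := T.finite i
instance (i : ℤ) : Module.Projective (Env k A) (T.complex.X i) := T.projective i

theorem exact_of {n i m : ℤ} (h : i + 1 = n) (h' : m + 1 = i) :
    Function.Exact (dd T.complex n i) (dd T.complex i m) := by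
  subst h
  obtain rfl : m = i - 1 := by omega
  exact T.exact i

theorem subtype_comp_proj (i : ℤ) :
    (T.syzygy i).subtype ∘ₗ T.proj i = dd T.complex i (i - 1) := rfl

theorem coe_proj (i : ℤ) (x : T.complex.X i) : (T.proj i x : T.complex.X (i - 1))
    = dd T.complex i (i - 1) x := rfl

theorem proj_eq_zero_iff {i : ℤ} {x : T.complex.X i} :
    T.proj i x = 0 ↔ dd T.complex i (i - 1) x = 0 :=
  Subtype.ext_iff

theorem proj_surjective (i : ℤ) : Function.Surjective (T.proj i) := by
  rintro ⟨y, hy⟩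
  obtain ⟨x, hx⟩ := (T.exact_of (sub_add_cancel i 1) (sub_add_cancel _ 1) y).1 hy
  exact ⟨x, Subtype.ext hx⟩

theorem exact_proj {n i : ℤ} (h : i + 1 = n) : Function.Exact (dd T.complex n i) (T.proj i) :=
  fun x => T.proj_eq_zero_iff.trans (T.exact_of h (sub_add_cancel i 1) x)

theorem proj_comp_subtype (i : ℤ) : T.proj (i - 1) ∘ₗ (T.syzygy i).subtype = 0 :=
  LinearMap.ext fun y => T.proj_eq_zero_iff.2 y.2

instance (i : ℤ) : Module.Finite (Env k A) (T.syzygy i) :=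
  Module.Finite.of_surjective (T.proj i) (T.proj_surjective i)

theorem exists_factor_proj {N : Type u} [AddCommGroup N] [Module (Env k A) N] {n i : ℤ}
    (h : i + 1 = n) {φ : T.complex.X i →ₗ[Env k A] N} (hφ : φ ∘ₗ dd T.complex n i = 0) :
    ∃ f : T.syzygy i →ₗ[Env k A] N, φ = f ∘ₗ T.proj i :=
  exists_factor (T.proj_surjective i) fun x hx => by
    obtain ⟨y, rfl⟩ := (T.exact_proj h x).1 hx
    exact LinearMap.congr_fun hφ y

/-- Maps to finitely generated projective bimodules extend along the differential. -/
theorem exists_extend {N : Type u} [AddCommGroup N] [Module (Env k A) N]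
    [Module.Finite (Env k A) N] [Module.Projective (Env k A) N] {n i : ℤ} (h : i + 1 = n)
    {φ : T.complex.X i →ₗ[Env k A] N} (hφ : φ ∘ₗ dd T.complex n i = 0) :
    ∃ s : T.complex.X (i - 1) →ₗ[Env k A] N, φ = s ∘ₗ dd T.complex i (i - 1) := by
  subst h
  -- Exactness of the dual complex concerns only maps into `Aᵉ`. The coordinates `ψ l ∘ φ` are
  -- extended one at a time and reassembled with the dual basis of `N`.
  obtain ⟨n, x, ψ, hψ⟩ := exists_dual_basis (Env k A) N
  have (l : Fin n) : ∃ s, pre (dd T.complex i (i - 1)) (Env k A) s = ψ l ∘ₗ φ :=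
    (T.dual_exact i _).1 (by
      change (ψ l ∘ₗ φ) ∘ₗ dd T.complex (i + 1) i = 0
      rw [LinearMap.comp_assoc, hφ, LinearMap.comp_zero])
  choose s hs using this
  refine ⟨∑ l, (s l).smulRight (x l), LinearMap.ext fun y => ?_⟩
  rw [← hψ (φ y), LinearMap.comp_apply, LinearMap.sum_apply]
  refine Finset.sum_congr rfl fun l _ => ?_
  rw [LinearMap.smulRight_apply]
  congr 1
  exact (LinearMap.congr_fun (hs l) y).symm

end General

end CompleteResolution

/-! ### Chain maps of arbitrary degree and their uniqueness in cohomology -/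

section ChainMaps

variable {T : CompleteResolution k A A}

variable (T) in
/-- A family of maps `T_p → T_q` whose members with `p = q + j` form a chain map of degree `j`. -/
def IsDegMap (j : ℤ) (G : ∀ p q : ℤ, T.complex.X p →ₗ[Env k A] T.complex.X q) : Prop :=
  ∀ p q : ℤ, q + j = p → dd T.complex q (q - 1) ∘ₗ G p q
    = sgn j • (G (p - 1) (q - 1) ∘ₗ dd T.complex p (p - 1))

namespace IsDegMap

variable {j : ℤ} {G G' : ∀ p q : ℤ, T.complex.X p →ₗ[Env k A] T.complex.X q}

theorem sub (hG : IsDegMap T j G) (hG' : IsDegMap T j G') :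
    IsDegMap T j fun p q => G p q - G' p q := fun p q h => by
  rw [LinearMap.comp_sub, LinearMap.sub_comp, hG p q h, hG' p q h, smul_sub]

theorem apply (hG : IsDegMap T j G) {p q : ℤ} (h : q + j = p) (x : T.complex.X p) :
    dd T.complex q (q - 1) (G p q x) = sgn j • G (p - 1) (q - 1) (dd T.complex p (p - 1) x) :=
  LinearMap.congr_fun (hG p q h) x

theorem apply' (hG : IsDegMap T j G) {p q p' q' : ℤ} (h : q + j = p) (hp : p' + 1 = p)
    (hq : q' + 1 = q) (x : T.complex.X p) :
    dd T.complex q q' (G p q x) = sgn j • G p' q' (dd T.complex p p' x) := by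
  obtain rfl : p' = p - 1 := by omega
  obtain rfl : q' = q - 1 := by omega
  exact hG.apply h x

/-- A chain map that is trivial in cohomology at one spot is trivial up to homotopy. -/
theorem exists_proj_comp (hG : IsDegMap T j G) (h0 : T.aug ∘ₗ G j 0 ∈ coboundaries T j) (q : ℤ) :
    ∀ p, q + j = p → ∃ h : T.complex.X (p - 1) →ₗ[Env k A] T.syzygy q,
      T.proj q ∘ₗ G p q = h ∘ₗ dd T.complex p (p - 1) := by
  induction q using int_induction with
  | h0 =>
    rintro p hp
    obtain rfl : p = j := by omega
    -- Both `ε` and `π_0` have kernel `Im d_1`, so `π_0` factors through `ε` and inherits the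
    -- hypothesis on `ε G_0`. Each degree needs only the existence of some factorisation; no
    -- coherent homotopy is assembled.
    obtain ⟨f, hf⟩ := exists_factor T.aug_surjective (φ := T.proj 0) fun x hx => by
      obtain ⟨y, rfl⟩ := (T.aug_exact x).1 hx
      exact (T.exact_proj (zero_add 1) _).2 ⟨y, rfl⟩
    obtain ⟨h, hh⟩ := h0
    refine ⟨f ∘ₗ h, ?_⟩
    rw [hf, LinearMap.comp_assoc, ← hh]
    rfl
  | hup q ih =>
    rintro p hp
    obtain ⟨h, hh⟩ := ih (p - 1) (by omega)
    -- Projectivity of `T_{p-2}` lifts `h` to `s : T_{p-2} → T_{q-1}`. Then `G_{p-1} - s d` lands in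
    -- `Ω^q`, and composing it with `d` gives `π_q G_p` up to sign, since `d d = 0`.
    obtain ⟨s, rfl⟩ := Module.projective_lifting_property (T.proj (q - 1)) h
      (T.proj_surjective _)
    let φ := G (p - 1) (q - 1) - s ∘ₗ dd T.complex (p - 1) (p - 1 - 1)
    have hφ (x) : φ x ∈ T.syzygy q := T.proj_eq_zero_iff.1 (by
      simpa [φ, sub_eq_zero] using LinearMap.congr_fun hh x)
    refine ⟨sgn j • φ.codRestrict _ hφ, LinearMap.ext fun x => Subtype.ext ?_⟩
    have := hG.apply hp x
    simp [CompleteResolution.coe_proj, this, φ, dd_dd]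
  | hdown q ih =>
    rintro p' hp
    obtain ⟨p, rfl⟩ : ∃ p, p' = p - 1 := ⟨p' + 1, by omega⟩
    obtain ⟨h, hh⟩ := ih p (by omega)
    -- Corrected by `h`, the map `G_{p-1}` kills the image of `d_p`, so it extends along `d_{p-1}`
    -- by exactness of the dual. The correction takes values in `Ω^q`, which `π_{q-1}` annihilates.
    let ψ := G (p - 1) (q - 1) - sgn j • ((T.syzygy q).subtype ∘ₗ h)
    obtain ⟨s, hs⟩ := T.exists_extend (sub_add_cancel p 1) (φ := ψ) (LinearMap.ext fun x => by
      have h1 := congrArg Subtype.val (LinearMap.congr_fun hh x)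
      rw [LinearMap.comp_apply, CompleteResolution.coe_proj, hG.apply (by omega) x] at h1
      simp only [ψ, LinearMap.comp_apply, LinearMap.sub_apply, LinearMap.smul_apply,
        Submodule.subtype_apply, LinearMap.zero_apply]
      rw [LinearMap.comp_apply] at h1
      rw [← h1, sgn_smul_sgn_smul, sub_self])
    refine ⟨T.proj (q - 1) ∘ₗ s, ?_⟩
    rw [LinearMap.comp_assoc, ← hs]
    simp only [ψ, LinearMap.comp_sub]
    rw [LinearMap.comp_smul, ← LinearMap.comp_assoc, T.proj_comp_subtype]
    simp

/-- A cocycle factors as `f π_i`, so only `π_i G` matters, and that factors through the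
differential. -/
theorem comp_mem_coboundaries (hG : IsDegMap T j G) (h0 : T.aug ∘ₗ G j 0 ∈ coboundaries T j)
    {i n : ℤ} (h : i + j = n) {u : T.complex.X i →ₗ[Env k A] A} (hu : u ∈ cocycles T i) :
    u ∘ₗ G n i ∈ coboundaries T n := by
  obtain ⟨f, rfl⟩ := T.exists_factor_proj rfl (cocycle_comp rfl hu)
  obtain ⟨s, hs⟩ := hG.exists_proj_comp h0 i n h
  exact ⟨f ∘ₗ s, by rw [LinearMap.comp_assoc, hs]; rfl⟩

theorem comp_mem_cocycles (hG : IsDegMap T j G) {i n : ℤ} (h : i + j = n)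
    {u : T.complex.X i →ₗ[Env k A] A} (hu : u ∈ cocycles T i) : u ∘ₗ G n i ∈ cocycles T n := by
  obtain ⟨f, rfl⟩ := T.exists_factor_proj rfl (cocycle_comp rfl hu)
  refine LinearMap.ext fun x => ?_
  change f (T.proj i (G n i (dd T.complex (n + 1) n x))) = 0
  have h1 := hG.apply' (p := n + 1) (q := i + 1) (p' := n) (q' := i) (by omega) rfl rfl x
  rw [show G n i (dd T.complex (n + 1) n x) = sgn j • dd T.complex (i + 1) i (G (n + 1) (i + 1) x)
    by rw [h1, sgn_smul_sgn_smul], (T.exact_proj rfl _).2, map_zero]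
  exact ⟨sgn j • G (n + 1) (i + 1) x, map_zsmul _ _ _⟩

/-- Composition with a chain map sends coboundaries to coboundaries. -/
theorem coboundary_comp (hG : IsDegMap T j G) {i n : ℤ} (h : i + j = n)
    {u : T.complex.X i →ₗ[Env k A] A} (hu : u ∈ coboundaries T i) :
    u ∘ₗ G n i ∈ coboundaries T n := by
  obtain ⟨h', rfl⟩ := hu
  refine ⟨sgn j • (h' ∘ₗ G (n - 1) (i - 1)), ?_⟩
  change _ = (h' ∘ₗ dd T.complex i (i - 1)) ∘ₗ G n i
  rw [LinearMap.comp_assoc, hG n i h, LinearMap.comp_smul]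
  rfl

theorem comp {l : ℤ} {H : ∀ p q : ℤ, T.complex.X p →ₗ[Env k A] T.complex.X q}
    (hG : IsDegMap T j G) (hH : IsDegMap T l H) :
    IsDegMap T (j + l) fun p q => G (q + j) q ∘ₗ H p (q + j) := by
  rintro p q h
  ext x
  simp only [LinearMap.comp_apply, LinearMap.smul_apply]
  rw [hG.apply' (p' := q - 1 + j) (q' := q - 1) rfl (by omega) (by omega),
    hH.apply' (p' := p - 1) (q' := q - 1 + j) (by omega) (by omega) (by omega), map_zsmul,
    smul_smul, sgn_add]

variable (T) in
theorem id : IsDegMap T 0 fun p q => if h : p = q then h ▸ LinearMap.id else 0 := by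
  intro p q h
  obtain rfl : q = p := by omega
  simp [sgn_zero]

/-- A chain map of degree `0` over the identity induces the identity in cohomology. -/
theorem comp_sub_mem_coboundaries (hG : IsDegMap T 0 G) (h0 : T.aug ∘ₗ G 0 0 = T.aug)
    {n : ℤ} {u : T.complex.X n →ₗ[Env k A] A} (hu : u ∈ cocycles T n) :
    u ∘ₗ G n n - u ∈ coboundaries T n := by
  have := (hG.sub (id T)).comp_mem_coboundaries
    (by simp [LinearMap.comp_sub, h0]) (add_zero n) hu
  simpa [LinearMap.comp_sub] using this

end IsDegMap

end ChainMaps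

/-! ## Cup products -/

section Multiply

variable {X Y Z X' Y' : Type u}
  [AddCommGroup X] [Module k X] [Module (Env k A) X] [IsScalarTower k (Env k A) X]
  [AddCommGroup Y] [Module k Y] [Module (Env k A) Y] [IsScalarTower k (Env k A) Y]
  [AddCommGroup Z] [Module k Z] [Module (Env k A) Z] [IsScalarTower k (Env k A) Z]
  [AddCommGroup X'] [Module k X'] [Module (Env k A) X'] [IsScalarTower k (Env k A) X']
  [AddCommGroup Y'] [Module k Y'] [Module (Env k A) Y'] [IsScalarTower k (Env k A) Y']

theorem TensorA.env_hom_ext {W : Type u} [AddCommGroup W] [Module (Env k A) W]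
    {f g : TensorA k A X Y →ₗ[Env k A] W}
    (h : ∀ x y, f (TensorA.tmul k A x y) = g (TensorA.tmul k A x y)) : f = g := by
  ext t
  induction t using TensorA.induction with
  | h0 => simp
  | h1 x y => exact h x y
  | h2 s t hs ht => simp [hs, ht]

variable (X) in
/-- `x ⊗ y ↦ x v(y)`. -/
def mulRight (v : Y →ₗ[Env k A] A) : TensorA k A X Y →ₗ[Env k A] X :=
  envLinear (TensorA.lift
      (LinearMap.mk₂ k (fun x y => Env.of k 1 (v y) • x)
        (fun x x' y => smul_add _ x x')
        (fun c x y => smul_comm _ c x)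
        (fun x y y' => by rw [map_add, Env.of_add, add_smul])
        (fun c x y => by rw [LinearMap.map_smul_of_tower, Env.of_smul, smul_assoc]))
      (fun a x y => by
        simp only [LinearMap.mk₂_apply]
        rw [map_smul, env_smul_def, ← mul_smul, Env.of_mul, mul_one, mul_one]))
    (fun a b t => by
      induction t using TensorA.induction with
      | h0 => simp
      | h1 x y =>
        rw [TensorA.smul_tmul, TensorA.lift_tmul, TensorA.lift_tmul]
        simp only [LinearMap.mk₂_apply]
        rw [map_smul, env_smul_def, ← mul_smul, ← mul_smul, Env.of_mul, Env.of_mul]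
        simp
      | h2 s t hs ht => simp only [smul_add, map_add, hs, ht])

theorem mulRight_tmul (v : Y →ₗ[Env k A] A) (x : X) (y : Y) :
    mulRight X v (TensorA.tmul k A x y) = Env.of k 1 (v y) • x := by
  simp only [mulRight, envLinear, LinearMap.coe_mk, AddHom.coe_mk]
  rw [TensorA.lift_tmul]; rfl

variable (Y) in
/-- `x ⊗ y ↦ u(x) y`. -/
def mulLeft (u : X →ₗ[Env k A] A) : TensorA k A X Y →ₗ[Env k A] Y :=
  envLinear (TensorA.lift
      (LinearMap.mk₂ k (fun x y => Env.of k (u x) 1 • y)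
        (fun x x' y => by rw [map_add, Env.add_of, add_smul])
        (fun c x y => by rw [LinearMap.map_smul_of_tower, Env.smul_of, smul_assoc])
        (fun x y y' => smul_add _ y y')
        (fun c x y => smul_comm _ c y))
      (fun a x y => by
        simp only [LinearMap.mk₂_apply]
        rw [map_smul, env_smul_def, ← mul_smul, Env.of_mul, one_mul, mul_one]))
    (fun a b t => by
      induction t using TensorA.induction with
      | h0 => simp
      | h1 x y =>
        rw [TensorA.smul_tmul, TensorA.lift_tmul, TensorA.lift_tmul]
        simp only [LinearMap.mk₂_apply]
        rw [map_smul, env_smul_def, ← mul_smul, ← mul_smul, Env.of_mul, Env.of_mul]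
        simp
      | h2 s t hs ht => simp only [smul_add, map_add, hs, ht])

theorem mulLeft_tmul (u : X →ₗ[Env k A] A) (x : X) (y : Y) :
    mulLeft Y u (TensorA.tmul k A x y) = Env.of k (u x) 1 • y := by
  simp only [mulLeft, envLinear, LinearMap.coe_mk, AddHom.coe_mk]
  rw [TensorA.lift_tmul]; rfl

/-- Since `u` and `v` are bimodule maps, `u(x) v(y)` is both `u(x v(y))` and, in the next lemma,
`v(u(x) y)`. These two readings of a product are the source of the unit laws and of graded
commutativity. -/
theorem comp_mulRight (u : X →ₗ[Env k A] A) (v : Y →ₗ[Env k A] A) :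
    u ∘ₗ mulRight X v = mulA k A ∘ₗ TensorA.map u v :=
  TensorA.env_hom_ext fun x y => by
    simp [mulRight_tmul, TensorA.map_tmul, mulA_tmul, env_smul_def]

theorem comp_mulLeft (u : X →ₗ[Env k A] A) (v : Y →ₗ[Env k A] A) :
    v ∘ₗ mulLeft Y u = mulA k A ∘ₗ TensorA.map u v :=
  TensorA.env_hom_ext fun x y => by
    simp [mulLeft_tmul, TensorA.map_tmul, mulA_tmul, env_smul_def]

theorem mulRight_map (v : Y' →ₗ[Env k A] A) (f : X →ₗ[Env k A] X') (g : Y →ₗ[Env k A] Y')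
    (t : TensorA k A X Y) :
    mulRight X' v (TensorA.map f g t) = f (mulRight X (v ∘ₗ g) t) :=
  LinearMap.congr_fun (f := mulRight X' v ∘ₗ TensorA.map f g) (g := f ∘ₗ mulRight X (v ∘ₗ g))
    (TensorA.env_hom_ext fun x y => by simp [mulRight_tmul, TensorA.map_tmul]) t

theorem mulLeft_map (u : X' →ₗ[Env k A] A) (f : X →ₗ[Env k A] X') (g : Y →ₗ[Env k A] Y')
    (t : TensorA k A X Y) :
    mulLeft Y' u (TensorA.map f g t) = g (mulLeft Y (u ∘ₗ f) t) :=
  LinearMap.congr_fun (f := mulLeft Y' u ∘ₗ TensorA.map f g) (g := g ∘ₗ mulLeft Y (u ∘ₗ f))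
    (TensorA.env_hom_ext fun x y => by simp [mulLeft_tmul, TensorA.map_tmul]) t

theorem mulRight_zero (t : TensorA k A X Y) : mulRight X (0 : Y →ₗ[Env k A] A) t = 0 :=
  LinearMap.congr_fun (g := 0) (TensorA.env_hom_ext fun x y => by
    rw [mulRight_tmul, LinearMap.zero_apply, LinearMap.zero_apply,
      ← zero_smul k (0 : A), Env.of_smul, zero_smul, zero_smul]) t

theorem mulLeft_zero (t : TensorA k A X Y) : mulLeft Y (0 : X →ₗ[Env k A] A) t = 0 :=
  LinearMap.congr_fun (g := 0) (TensorA.env_hom_ext fun x y => by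
    rw [mulLeft_tmul, LinearMap.zero_apply, LinearMap.zero_apply,
      ← zero_smul k (0 : A), Env.smul_of, zero_smul, zero_smul]) t

theorem cupMap_eq (D : Z →ₗ[Env k A] TensorA k A X Y) (u : X →ₗ[Env k A] A)
    (v : Y →ₗ[Env k A] A) : cupMap D u v = u ∘ₗ mulRight X v ∘ₗ D := by
  rw [← LinearMap.comp_assoc, comp_mulRight]; rfl

theorem cupMap_eq' (D : Z →ₗ[Env k A] TensorA k A X Y) (u : X →ₗ[Env k A] A)
    (v : Y →ₗ[Env k A] A) : cupMap D u v = v ∘ₗ mulLeft Y u ∘ₗ D := by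
  rw [← LinearMap.comp_assoc, comp_mulLeft]; rfl

variable {M : Type u} [AddCommGroup M] [Module k M] [Module (Env k A) M]
  [IsScalarTower k (Env k A) M]

/-- Over `Aᵉ` one has `x ⊗ u(y) m = x u(y) ⊗ m`. Hence the cap product, like the cup product, is
application of `(1 ⊗̂ u) Δ`. -/
theorem contract_eq (u : Y →ₗ[Env k A] A) (t : TensorA k A X Y) (m : M) :
    contract M u t m = TensorE.tmul k A (mulRight X u t) m := by
  induction t using TensorA.induction with
  | h0 =>
    rw [map_zero, map_zero, LinearMap.zero_apply, ← TensorE.mk₂_apply, map_zero,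
      LinearMap.zero_apply]
  | h1 x y => rw [contract_tmul, mulRight_tmul, TensorE.balanced]
  | h2 s t hs ht =>
    rw [map_add, map_add, LinearMap.add_apply, hs, ht]
    exact (LinearMap.map_add₂ (TensorE.mk₂ k A X M) _ _ m).symm

theorem capMap_eq (D : Z →ₗ[Env k A] TensorA k A X Y) (u : Y →ₗ[Env k A] A)
    (t : TensorE k A Z M) :
    capMap M D u t = TensorE.map (mulRight X u ∘ₗ D) LinearMap.id t :=
  LinearMap.congr_fun (TensorE.hom_ext fun z m => by
    rw [capMap_tmul, contract_eq, TensorE.map_tmul]; rfl) t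

end Multiply

/-! ### The chain maps attached to a cocycle by the diagonal approximation -/

section Lifts

variable {T : CompleteResolution k A A} (Δ : DiagonalApproximation T)

/-- The family of maps `(1 ⊗̂ v) Δ : T_{q+j} → T_q` attached to `v : T_j → A`. -/
def rightLift {j : ℤ} (v : T.complex.X j →ₗ[Env k A] A) (p q : ℤ) :
    T.complex.X p →ₗ[Env k A] T.complex.X q :=
  -- The sign of moving `v` past `T_q` makes this a chain map for the differential `(-1)^j d`, and
  -- makes `u ∘ rightLift v` equal to `u ⌣ v` exactly. In `leftLift` no sign is needed: the `(-1)^i`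
  -- comes from the differential of the tensor product. Indexing by both `p` and `q`, with zero off
  -- the diagonal `q + j = p`, avoids transport along equations of integers.
  if h : q + j = p then sgn (q * j) • (mulRight _ v ∘ₗ Δ.comp p q j h) else 0

/-- The family of maps `(u ⊗̂ 1) Δ : T_{i+q} → T_q` attached to `u : T_i → A`. -/
def leftLift {i : ℤ} (u : T.complex.X i →ₗ[Env k A] A) (p q : ℤ) :
    T.complex.X p →ₗ[Env k A] T.complex.X q :=
  if h : i + q = p then mulLeft _ u ∘ₗ Δ.comp p i q h else 0

variable {Δ}

theorem rightLift_eq {j : ℤ} (v : T.complex.X j →ₗ[Env k A] A) {p q : ℤ} (h : q + j = p) :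
    rightLift Δ v p q = sgn (q * j) • (mulRight _ v ∘ₗ Δ.comp p q j h) := dif_pos h

theorem leftLift_eq {i : ℤ} (u : T.complex.X i →ₗ[Env k A] A) {p q : ℤ} (h : i + q = p) :
    leftLift Δ u p q = mulLeft _ u ∘ₗ Δ.comp p i q h := dif_pos h

theorem isDegMap_rightLift {j : ℤ} {v : T.complex.X j →ₗ[Env k A] A} (hv : v ∈ cocycles T j) :
    IsDegMap T j (rightLift Δ v) := by
  intro p q h
  ext x
  rw [rightLift_eq v h, rightLift_eq v (p := p - 1) (q := q - 1) (by omega)]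
  simp only [LinearMap.comp_apply, LinearMap.smul_apply, map_zsmul]
  rw [Δ.comp_d (p - 1) (q - 1) j p q (j + 1) (by omega) (by omega) (by omega) rfl, map_add,
    map_zsmul, mulRight_map, mulRight_map, cocycle_comp rfl hv, mulRight_zero, LinearMap.comp_id,
    map_zero, smul_zero, add_zero, smul_smul, ← sgn_add]
  congr 2
  ring

theorem isDegMap_leftLift {i : ℤ} {u : T.complex.X i →ₗ[Env k A] A} (hu : u ∈ cocycles T i) :
    IsDegMap T i (leftLift Δ u) := by
  intro p q h
  ext x
  rw [leftLift_eq u (p := p) (by omega), leftLift_eq u (p := p - 1) (q := q - 1) (by omega)]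
  simp only [LinearMap.comp_apply, LinearMap.smul_apply]
  rw [Δ.comp_d (p - 1) i (q - 1) p (i + 1) q (by omega) (by omega) rfl (by omega), map_add,
    map_zsmul, mulLeft_map, mulLeft_map, cocycle_comp rfl hu, mulLeft_zero, LinearMap.comp_id,
    map_zero, zero_add, sgn_smul_sgn_smul]

theorem comp_rightLift {i j n : ℤ} (u : T.complex.X i →ₗ[Env k A] A)
    (v : T.complex.X j →ₗ[Env k A] A) (h : i + j = n) :
    u ∘ₗ rightLift Δ v n i = sgn (i * j) • cupMap (Δ.comp n i j h) u v := by
  rw [rightLift_eq v h, LinearMap.comp_smul, cupMap_eq]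

theorem comp_leftLift {i j n : ℤ} (u : T.complex.X i →ₗ[Env k A] A)
    (v : T.complex.X j →ₗ[Env k A] A) (h : i + j = n) :
    v ∘ₗ leftLift Δ u n j = cupMap (Δ.comp n i j h) u v := by
  rw [leftLift_eq u h, cupMap_eq']

variable (Δ)

theorem cupMap_aug_aug : cupMap (Δ.comp 0 0 0 (zero_add 0)) T.aug T.aug = T.aug :=
  LinearMap.ext Δ.aug

/-- The augmentation is a left unit up to coboundaries. -/
theorem aug_comp_rightLift {j : ℤ} {v : T.complex.X j →ₗ[Env k A] A} (hv : v ∈ cocycles T j) :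
    T.aug ∘ₗ rightLift Δ v j 0 - v ∈ coboundaries T j := by
  -- The condition on `Δ` involves `ε` only in degree `0`, so `ε ⌣ v` is not compared with `v`
  -- directly. It is reread as `v ∘ leftLift ε`, where `leftLift ε` lies over the identity of `A`.
  rw [comp_rightLift _ _ (zero_add j), zero_mul, sgn_zero, one_smul, ← comp_leftLift]
  refine (isDegMap_leftLift (aug_mem_cocycles T)).comp_sub_mem_coboundaries ?_ hv
  rw [comp_leftLift _ _ (zero_add 0), cupMap_aug_aug]

/-- The augmentation is a right unit up to coboundaries. -/
theorem aug_comp_leftLift {i : ℤ} {u : T.complex.X i →ₗ[Env k A] A} (hu : u ∈ cocycles T i) :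
    T.aug ∘ₗ leftLift Δ u i 0 - u ∈ coboundaries T i := by
  have h := comp_rightLift (Δ := Δ) u T.aug (add_zero i)
  rw [mul_zero, sgn_zero, one_smul] at h
  rw [comp_leftLift _ _ (add_zero i), ← h]
  refine (isDegMap_rightLift (aug_mem_cocycles T)).comp_sub_mem_coboundaries ?_ hu
  rw [comp_rightLift _ _ (zero_add 0), cupMap_aug_aug, zero_mul, sgn_zero, one_smul]

variable {Δ}

/-- The cup product with `v` is composition with any chain map that lifts `v`. -/
theorem IsDegMap.comp_sub_cup {j : ℤ} {G : ∀ p q : ℤ, T.complex.X p →ₗ[Env k A] T.complex.X q}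
    (hG : IsDegMap T j G) {v : T.complex.X j →ₗ[Env k A] A} (hv : v ∈ cocycles T j)
    (h0 : T.aug ∘ₗ G j 0 - v ∈ coboundaries T j) {i n : ℤ} (h : i + j = n)
    {u : T.complex.X i →ₗ[Env k A] A} (hu : u ∈ cocycles T i) :
    u ∘ₗ G n i - u ∘ₗ rightLift Δ v n i ∈ coboundaries T n := by
  rw [← LinearMap.comp_sub]
  refine (hG.sub (isDegMap_rightLift hv)).comp_mem_coboundaries ?_ h hu
  rw [LinearMap.comp_sub]
  simpa using Submodule.sub_mem _ h0 (aug_comp_rightLift Δ hv)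

end Lifts

/-! ### Graded commutativity and associativity of Tate-Hochschild cohomology -/

section Algebra

variable {T : CompleteResolution k A A} (Δ : DiagonalApproximation T)

theorem tateMk_eq_iff {n : ℤ} {u v : cocycles T n} :
    (Submodule.Quotient.mk u : TateCohomology T n) = Submodule.Quotient.mk v
      ↔ u.1 - v.1 ∈ coboundaries T n :=
  Submodule.Quotient.eq _

/-- Degrees such as `i + j + l` and `i + (j + l)` are only propositionally equal; this reduces an
identity in the direct sum to a congruence of transported cochains. -/
theorem lof_mk_eq {m n : ℤ} (h : m = n) {u : cocycles T m} {v : cocycles T n}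
    (huv : (h ▸ u.1) - v.1 ∈ coboundaries T n) :
    DirectSum.lof k ℤ (fun i => TateCohomology T i) m (Submodule.Quotient.mk u)
      = DirectSum.lof k ℤ (fun i => TateCohomology T i) n (Submodule.Quotient.mk v) := by
  subst h
  rw [tateMk_eq_iff.2 huv]

theorem cast_comp_rightLift {i j m n : ℤ} (h : m = n) (u : T.complex.X i →ₗ[Env k A] A)
    (v : T.complex.X j →ₗ[Env k A] A) :
    (h ▸ (u ∘ₗ rightLift Δ v m i) : T.complex.X n →ₗ[Env k A] A) = u ∘ₗ rightLift Δ v n i := by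
  subst h; rfl

theorem cup_mk (i j : ℤ) (u : cocycles T i) (v : cocycles T j) :
    cup Δ i j (Submodule.Quotient.mk u) (Submodule.Quotient.mk v)
      = Submodule.Quotient.mk ⟨u.1 ∘ₗ rightLift Δ v.1 (i + j) i,
        (isDegMap_rightLift v.2).comp_mem_cocycles rfl u.2⟩ := by
  refine tateMk_eq_iff.2 ?_
  simp only [comp_rightLift _ _ (rfl : i + j = i + j)]
  change cupCochain Δ i j u.1 v.1 - _ ∈ _
  simp [cupCochain]

theorem cast_sgn_smul_sub {V : Type*} [AddCommGroup V] [Module k V] (n : ℤ) (a b : V) :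
    (sgn n : k) • a - sgn n • b = (-(sgn n : k)) • (b - a) := by
  rcases sgn_eq_or n with h | h <;> simp [h, neg_add_eq_sub]

theorem isGradedCommAlgebra_cup :
    IsGradedCommAlgebra (k := k) (H := fun i => TateCohomology T i) (cup Δ) (tateOne T) where
  one_mul i x := by
    obtain ⟨v, rfl⟩ := Submodule.Quotient.mk_surjective _ x
    rw [tateOne, cup_mk]
    refine lof_mk_eq (zero_add i) ?_
    rw [cast_comp_rightLift]
    exact aug_comp_rightLift Δ v.2
  mul_one i x := by
    obtain ⟨u, rfl⟩ := Submodule.Quotient.mk_surjective _ x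
    rw [tateOne, cup_mk]
    refine lof_mk_eq (add_zero i) ?_
    rw [cast_comp_rightLift]
    refine (isDegMap_rightLift (aug_mem_cocycles T)).comp_sub_mem_coboundaries ?_ u.2
    rw [comp_rightLift _ _ (zero_add 0), cupMap_aug_aug, zero_mul, sgn_zero, one_smul]
  mul_assoc i j l x y z := by
    obtain ⟨u, rfl⟩ := Submodule.Quotient.mk_surjective _ x
    obtain ⟨v, rfl⟩ := Submodule.Quotient.mk_surjective _ y
    obtain ⟨w, rfl⟩ := Submodule.Quotient.mk_surjective _ z
    rw [cup_mk, cup_mk, cup_mk, cup_mk]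
    refine (lof_mk_eq (add_assoc i j l).symm ?_).symm
    rw [cast_comp_rightLift, ← Submodule.neg_mem_iff, neg_sub]
    -- The composite of the lifts of `v` and `w` is a lift of `v ⌣ w`, so composing `u` with it
    -- computes `u ⌣ (v ⌣ w)` up to a coboundary; on the nose it gives `(u ⌣ v) ⌣ w`.
    have hG := (isDegMap_rightLift (Δ := Δ) v.2).comp (isDegMap_rightLift (Δ := Δ) w.2)
    refine hG.comp_sub_cup ((isDegMap_rightLift w.2).comp_mem_cocycles rfl v.2) ?_
      (add_assoc i j l).symm u.2
    -- The composite passes through degree `0 + j`; generalising this index to `m` allows it to be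
    -- replaced by `j`.
    have h0 (m : ℤ) (hm : m = j) :
        T.aug ∘ₗ rightLift Δ v.1 m 0 ∘ₗ rightLift Δ w.1 (j + l) m
          - v.1 ∘ₗ rightLift Δ w.1 (j + l) j ∈ coboundaries T (j + l) := by
      subst hm
      rw [← LinearMap.comp_assoc, ← LinearMap.sub_comp]
      exact (isDegMap_rightLift w.2).coboundary_comp rfl (aug_comp_rightLift Δ v.2)
    exact h0 _ (zero_add j)
  mul_comm i j x y := by
    obtain ⟨u, rfl⟩ := Submodule.Quotient.mk_surjective _ x
    obtain ⟨v, rfl⟩ := Submodule.Quotient.mk_surjective _ y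
    rw [cup_mk, cup_mk, ← map_smul, ← Submodule.Quotient.mk_smul]
    refine (lof_mk_eq (add_comm j i) ?_).symm
    have hcast {m n : ℤ} (h : m = n) (c : k) : (h ▸ (c • (v.1 ∘ₗ rightLift Δ u.1 m j)) :
        T.complex.X n →ₗ[Env k A] A) = c • (v.1 ∘ₗ rightLift Δ u.1 n j) := by
      subst h; rfl
    -- `leftLift u` is a second lift of `u`, so `v ∘ leftLift u` represents `v ⌣ u`. But it is also
    -- the unsigned product of `u` and `v`, which differs from `u ⌣ v` by `(-1)^{ij}`.
    have hL := (isDegMap_leftLift (Δ := Δ) u.2).comp_sub_cup (Δ := Δ) u.2 (aug_comp_leftLift Δ u.2)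
      (add_comm j i) v.2
    rw [comp_leftLift _ _ rfl] at hL
    refine (congrArg (· ∈ coboundaries T (i + j)) ?_).mpr
      (Submodule.smul_mem _ (-(sgn (i * j) : k)) hL)
    refine (congrArg₂ (· - ·) (hcast (add_comm j i) _) (comp_rightLift _ _ rfl)).trans ?_
    exact cast_sgn_smul_sub _ _ _

end Algebra

/-! ## Stable Hochschild cohomology -/

section StableCohomology

variable (T : CompleteResolution k A A)

theorem comp_proj_mem_cocycles {i : ℤ} (f : T.syzygy i →ₗ[Env k A] A) :
    f ∘ₗ T.proj i ∈ cocycles T i := by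
  refine LinearMap.ext fun x => ?_
  change f (T.proj i (dd T.complex (i + 1) i x)) = 0
  rw [(T.exact_proj rfl _).2 ⟨x, rfl⟩, map_zero]

/-- The map `f ↦ [f π_i]`. -/
def tateClass (i : ℤ) : (T.syzygy i →ₗ[Env k A] A) →ₗ[k] TateCohomology T i where
  toFun f := Submodule.Quotient.mk ⟨f ∘ₗ T.proj i, comp_proj_mem_cocycles T f⟩
  map_add' _ _ := rfl
  map_smul' _ _ := rfl

theorem tateClass_apply (i : ℤ) (f : T.syzygy i →ₗ[Env k A] A) :
    tateClass T i f = Submodule.Quotient.mk ⟨f ∘ₗ T.proj i, comp_proj_mem_cocycles T f⟩ := rfl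

theorem tateClass_surjective (i : ℤ) : Function.Surjective (tateClass T i) := by
  intro x
  obtain ⟨⟨u, hu⟩, rfl⟩ := Submodule.Quotient.mk_surjective _ x
  obtain ⟨f, rfl⟩ := T.exists_factor_proj rfl (cocycle_comp rfl hu)
  exact ⟨f, rfl⟩

theorem env_smul_one_surjective :
    Function.Surjective (LinearMap.toSpanSingleton (Env k A) A 1) := fun a =>
  ⟨Env.of k a 1, by simp [env_smul_def]⟩

/-- If `f π_i = h d_i`, then `f` is the restriction of `h` to `Ω^i A ⊆ T_{i-1}`, so it factors
through a projective. Conversely a map that factors through a projective factors through `Aᵉ → A`,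
and the resulting map `T_i → Aᵉ` extends along `d_i` by exactness of the dual. -/
theorem projHoms_eq_ker (i : ℤ) :
    projHoms (k := k) (T.syzygy i) A = LinearMap.ker (tateClass T i) := by
  ext f
  rw [LinearMap.mem_ker, tateClass_apply, Submodule.Quotient.mk_eq_zero]
  change _ ↔ f ∘ₗ T.proj i ∈ coboundaries T i
  constructor
  · rintro ⟨P, _, _, g, h, hP, rfl⟩
    -- The projective `P` need not be finitely generated; lifting `h` along the epimorphism `Aᵉ → A`
    -- replaces it by `Aᵉ`.
    obtain ⟨h', hh'⟩ := Module.projective_lifting_property _ h (env_smul_one_surjective (A := A))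
    obtain ⟨s, hs⟩ := T.exists_extend rfl (φ := (h' ∘ₗ g) ∘ₗ T.proj i) (LinearMap.ext fun x => by
      change h' (g (T.proj i (dd T.complex (i + 1) i x))) = 0
      rw [(T.exact_proj rfl _).2 ⟨x, rfl⟩, map_zero, map_zero])
    refine ⟨LinearMap.toSpanSingleton (Env k A) A 1 ∘ₗ s, ?_⟩
    change LinearMap.toSpanSingleton (Env k A) A 1 ∘ₗ (s ∘ₗ dd T.complex i (i - 1)) = _
    rw [← hs, ← hh']
    rfl
  · rintro ⟨h, hh⟩
    refine ⟨T.complex.X (i - 1), inferInstance, inferInstance, (T.syzygy i).subtype, h,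
      T.projective _, LinearMap.ext fun y => ?_⟩
    obtain ⟨x, rfl⟩ := T.proj_surjective i y
    exact (LinearMap.congr_fun hh x).symm

/-- The isomorphism `[f] ↦ [f π_i]` from stable to Tate-Hochschild cohomology. -/
def stableHomEquiv (i : ℤ) :
    StableHom (k := k) (A := A) (T.syzygy i) A ≃ₗ[k] TateCohomology T i :=
  (Submodule.quotEquivOfEq _ _ (projHoms_eq_ker T i)).trans
    ((tateClass T i).quotKerEquivOfSurjective (tateClass_surjective T i))

theorem stableHomEquiv_mk (i : ℤ) (f : T.syzygy i →ₗ[Env k A] A) :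
    stableHomEquiv T i (Submodule.Quotient.mk f)
      = Submodule.Quotient.mk ⟨f ∘ₗ T.proj i, comp_proj_mem_cocycles T f⟩ := rfl

theorem stableHom_mk_eq_iff {i : ℤ} {f g : T.syzygy i →ₗ[Env k A] A} :
    (Submodule.Quotient.mk f : StableHom (k := k) (A := A) (T.syzygy i) A)
      = Submodule.Quotient.mk g ↔ f ∘ₗ T.proj i - g ∘ₗ T.proj i ∈ coboundaries T i := by
  rw [← (stableHomEquiv T i).injective.eq_iff, stableHomEquiv_mk, stableHomEquiv_mk,
    tateMk_eq_iff]

variable {T} (Δ : DiagonalApproximation T)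

/-- Every stable class is represented by a map whose pullback is the augmentation of the chain
map attached to a given representative. -/
theorem exists_rep_rightLift {j : ℤ} (f : T.syzygy j →ₗ[Env k A] A) :
    ∃ f₀ : T.syzygy j →ₗ[Env k A] A,
      (Submodule.Quotient.mk f₀ : StableHom (k := k) (A := A) (T.syzygy j) A)
        = Submodule.Quotient.mk f ∧
      T.aug ∘ₗ rightLift Δ (f ∘ₗ T.proj j) j 0 = f₀ ∘ₗ T.proj j := by
  have hv := comp_proj_mem_cocycles T f
  obtain ⟨f₀, hf₀⟩ := T.exists_factor_proj rfl (cocycle_comp rfl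
    ((isDegMap_rightLift (Δ := Δ) hv).comp_mem_cocycles (zero_add j) (aug_mem_cocycles T)))
  exact ⟨f₀, (stableHom_mk_eq_iff T).2 (hf₀ ▸ aug_comp_rightLift Δ hv), hf₀⟩

/-- The cup product on stable Hochschild cohomology. -/
def stableCup (i j : ℤ) : StableHom (k := k) (A := A) (T.syzygy i) A →ₗ[k]
    StableHom (k := k) (A := A) (T.syzygy j) A →ₗ[k]
    StableHom (k := k) (A := A) (T.syzygy (i + j)) A :=
  ((cup Δ i j).compl₁₂ (stableHomEquiv T i).toLinearMap (stableHomEquiv T j).toLinearMap).compr₂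
    (stableHomEquiv T (i + j)).symm.toLinearMap

theorem stableHomEquiv_stableCup (i j : ℤ) (f g) :
    stableHomEquiv T (i + j) (stableCup Δ i j f g)
      = cup Δ i j (stableHomEquiv T i f) (stableHomEquiv T j g) :=
  (stableHomEquiv T (i + j)).apply_symm_apply _

/-- `f₀ ω π_{i+j} = f₀ π_i G_i`, and `G` is a lift of `g₀ π_j`; any lift computes the cup product.
-/
theorem IsOmega.mk_comp {i j : ℤ} {f₀ : T.syzygy i →ₗ[Env k A] A}
    {g₀ : T.syzygy j →ₗ[Env k A] A} {ω : T.syzygy (i + j) →ₗ[Env k A] T.syzygy i}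
    (hω : IsOmega T i j g₀ ω) : Submodule.Quotient.mk (f₀ ∘ₗ ω)
      = stableCup Δ i j (Submodule.Quotient.mk f₀) (Submodule.Quotient.mk g₀) := by
  obtain ⟨G, hG, h0, hGω⟩ := hω
  apply (stableHomEquiv T (i + j)).injective
  rw [stableHomEquiv_stableCup, stableHomEquiv_mk, stableHomEquiv_mk, stableHomEquiv_mk, cup_mk,
    tateMk_eq_iff]
  have hG' : IsDegMap T j G := hG
  have := hG'.comp_sub_cup (Δ := Δ) (comp_proj_mem_cocycles T g₀)
    (by rw [h0, sub_self]; exact Submodule.zero_mem _) (rfl : i + j = i + j)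
    (comp_proj_mem_cocycles T f₀)
  rwa [LinearMap.comp_assoc, hGω, ← LinearMap.comp_assoc] at this

/-- The relation with all its choices is the graph of the product transported along `Φ`, so `∪` is
well defined and bilinear. -/
theorem isStableCup_iff (i j : ℤ) (f g h) :
    IsStableCup T i j f g h ↔ h = stableCup Δ i j f g := by
  constructor
  · rintro ⟨f₀, g₀, ω, rfl, rfl, hω, rfl⟩
    exact hω.mk_comp Δ
  · rintro rfl
    obtain ⟨f, rfl⟩ := Submodule.Quotient.mk_surjective _ f
    obtain ⟨g, rfl⟩ := Submodule.Quotient.mk_surjective _ g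
    -- `IsOmega` asks for `ε G_0 = g π_j` exactly, while `rightLift` satisfies it only up to a
    -- coboundary. The representative of the class is changed, not the chain map.
    obtain ⟨g₀, hg₀, haug⟩ := exists_rep_rightLift Δ g
    have hG := isDegMap_rightLift (Δ := Δ) (comp_proj_mem_cocycles T g)
    obtain ⟨ω, hω⟩ := T.exists_factor_proj rfl
      (φ := T.proj i ∘ₗ rightLift Δ (g ∘ₗ T.proj j) (i + j) i) (LinearMap.ext fun x => by
        refine Subtype.ext ?_
        change dd T.complex i (i - 1) (rightLift Δ (g ∘ₗ T.proj j) (i + j) i _) = 0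
        rw [hG.apply rfl, dd_dd, map_zero, smul_zero])
    have h : IsOmega T i j g₀ ω := ⟨_, hG, haug, hω⟩
    exact ⟨f, g₀, ω, rfl, hg₀, h, by rw [h.mk_comp Δ, hg₀]⟩

/-- The laws are pulled back along the injective map of direct sums with components `Φ_i`. -/
theorem isGradedCommAlgebra_stableCup :
    IsGradedCommAlgebra (k := k) (H := fun i => StableHom (k := k) (A := A) (T.syzygy i) A)
      (stableCup Δ) ((stableHomEquiv T 0).symm (tateOne T)) := by
  have hinj := (DirectSum.lmap_injective
    (fun i : ℤ => (stableHomEquiv T i).toLinearMap)).2 fun i => (stableHomEquiv T i).injective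
  have h := isGradedCommAlgebra_cup Δ
  constructor
  · intro i x
    refine hinj ((DirectSum.lmap_lof _ _ _).trans (Eq.trans ?_ (DirectSum.lmap_lof _ _ _).symm))
    refine Eq.trans (congrArg _ ?_) (h.one_mul i (stableHomEquiv T i x))
    refine (stableHomEquiv_stableCup Δ _ _ _ _).trans ?_
    rw [LinearEquiv.apply_symm_apply]
  · intro i x
    refine hinj ((DirectSum.lmap_lof _ _ _).trans (Eq.trans ?_ (DirectSum.lmap_lof _ _ _).symm))
    refine Eq.trans (congrArg _ ?_) (h.mul_one i (stableHomEquiv T i x))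
    refine (stableHomEquiv_stableCup Δ _ _ _ _).trans ?_
    rw [LinearEquiv.apply_symm_apply]
  · intro i j l x y z
    refine hinj ((DirectSum.lmap_lof _ _ _).trans (Eq.trans ?_ (DirectSum.lmap_lof _ _ _).symm))
    refine Eq.trans (congrArg _ ?_) ((h.mul_assoc i j l (stableHomEquiv T i x)
      (stableHomEquiv T j y) (stableHomEquiv T l z)).trans (congrArg _ ?_))
    · refine (stableHomEquiv_stableCup Δ _ _ _ _).trans ?_
      rw [stableHomEquiv_stableCup]
    · refine ((stableHomEquiv_stableCup Δ _ _ _ _).trans ?_).symm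
      rw [stableHomEquiv_stableCup]
  · intro i j x y
    refine hinj ((DirectSum.lmap_lof _ _ _).trans (Eq.trans ?_ ((map_smul _ _ _).trans
      (congrArg _ (DirectSum.lmap_lof _ _ _))).symm))
    refine Eq.trans (congrArg _ (stableHomEquiv_stableCup Δ _ _ _ _))
      ((h.mul_comm i j _ _).trans (congrArg _ (congrArg _ ?_)))
    exact (stableHomEquiv_stableCup Δ _ _ _ _).symm

end StableCohomology

/-! ## Stable Hochschild homology -/

section StableTensor

variable {M N : Type u} [AddCommGroup M] [Module (Env k A) M]
  [AddCommGroup N] [Module k N] [Module (Env k A) N] [IsScalarTower k (Env k A) N]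

/-- An element of `Ω^j M ⊗ N` is stable if and only if it vanishes in `T_{j-1} ⊗ N`. -/
theorem mem_stableTensor_iff [Module.Finite k A] (hA : IsFrobenius k A)
    [Module.Finite (Env k A) N] (T : CompleteResolution k A M) (j : ℤ)
    {w : TensorE k A (T.syzygy j) N} :
    w ∈ stableTensor (k := k) (A := A) (T.syzygy j) N
      ↔ TensorE.map (T.syzygy j).subtype LinearMap.id w = 0 := by
  obtain ⟨I, _, _, _, _, ι, hfin, hproj, hinj, hι⟩ := exists_injective_hull hA N
  -- In this square `T_{j-1} ⊗ N → T_{j-1} ⊗ I` is injective since `T_{j-1}` is flat, and `Ω^j M ⊗ I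
  -- → T_{j-1} ⊗ I` is injective since `I` is. So `w` dies in `T_{j-1} ⊗ N` if and only if it dies
  -- in `Ω^j M ⊗ I`.
  have hcomm : TensorE.map LinearMap.id ι (TensorE.map (T.syzygy j).subtype LinearMap.id w)
      = TensorE.map (T.syzygy j).subtype LinearMap.id (TensorE.map LinearMap.id ι w) := by
    rw [TensorE.map_map, TensorE.map_map]; rfl
  constructor
  · intro hw
    apply TensorE.map_id_injective (X := T.complex.X (j - 1)) hι
    rw [hcomm, hw I ι hinj hι, map_zero, map_zero]
  · intro hw I' _ _ _ _ ι' hI' _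
    -- Any other map to an injective factors through `ι`, so testing the single embedding `ι`
    -- suffices.
    obtain ⟨e, he⟩ := hI'.out ι hι ι'
    obtain rfl : ι' = e ∘ₗ ι := LinearMap.ext fun x => (he x).symm
    have h0 : TensorE.map (LinearMap.id : T.syzygy j →ₗ[Env k A] T.syzygy j) ι w = 0 := by
      apply TensorE.map_id_injective' (X := I) (T.syzygy j).injective_subtype
      rw [← hcomm, hw, map_zero, map_zero]
    rw [← LinearMap.id_comp (LinearMap.id : T.syzygy j →ₗ[Env k A] T.syzygy j),
      ← TensorE.map_map, h0, map_zero]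

end StableTensor

/-! ### Stable tensor products as Tate-Hochschild homology -/

section StableHomology

variable [Module.Finite k A] (T : CompleteResolution k A A)
  (M : Type u) [AddCommGroup M] [Module k M] [Module (Env k A) M]
  [IsScalarTower k (Env k A) M] [Module.Finite (Env k A) M]

theorem homologyD_eq (j : ℤ) (z : TensorE k A (T.complex.X j) M) :
    homologyD T M j (j - 1) z
      = TensorE.map (T.syzygy j).subtype LinearMap.id (TensorE.map (T.proj j) LinearMap.id z) := by
  rw [TensorE.map_map]; rfl

variable {M} in
theorem mem_cycles_iff (hA : IsFrobenius k A) {j : ℤ} {z : TensorE k A (T.complex.X j) M} :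
    z ∈ cycles T M j ↔ TensorE.map (T.proj j) LinearMap.id z
      ∈ stableTensor (k := k) (A := A) (T.syzygy j) M := by
  rw [mem_stableTensor_iff hA, ← homologyD_eq]; rfl

variable (hA : IsFrobenius k A)

/-- The map from cycles to the stable tensor product induced by `π_j`. -/
def cyclesToStable (j : ℤ) :
    cycles T M j →ₗ[k] stableTensor (k := k) (A := A) (T.syzygy j) M where
  toFun z := ⟨TensorE.map (T.proj j) LinearMap.id z.1, (mem_cycles_iff T hA).1 z.2⟩
  map_add' z z' := Subtype.ext (map_add (TensorE.map (T.proj j) LinearMap.id) z.1 z'.1)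
  map_smul' c z := Subtype.ext (map_smul (TensorE.map (T.proj j) LinearMap.id) c z.1)

theorem cyclesToStable_surjective (j : ℤ) : Function.Surjective (cyclesToStable T M hA j) := by
  rintro ⟨w, hw⟩
  obtain ⟨z, rfl⟩ := TensorE.map_surjective (T.proj_surjective j)
    (show Function.Surjective (LinearMap.id : M →ₗ[Env k A] M) from Function.surjective_id) w
  exact ⟨⟨z, (mem_cycles_iff T hA).2 hw⟩, rfl⟩

/-- Right exactness of `- ⊗ M`, applied to `T_{j+1} → T_j → Ω^j A → 0`. -/
theorem boundaries_eq_ker (j : ℤ) :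
    (boundaries T M j).submoduleOf (cycles T M j) = LinearMap.ker (cyclesToStable T M hA j) := by
  ext z
  rw [LinearMap.mem_ker, Subtype.ext_iff]
  change z.1 ∈ boundaries T M j ↔ TensorE.map (T.proj j) LinearMap.id z.1 = 0
  constructor
  · rintro ⟨c, hc⟩
    rw [← hc, homologyD, TensorE.map_map, show T.proj j ∘ₗ dd T.complex (j + 1) j = 0 from
      LinearMap.ext fun x => (T.exact_proj rfl _).2 ⟨x, rfl⟩, TensorE.map_zero_left]
  · intro h
    obtain ⟨a, b, hab⟩ := TensorE.exists_of_map_eq_zero (T.proj_surjective j)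
      (show Function.Surjective (LinearMap.id : M →ₗ[Env k A] M) from Function.surjective_id)
      (T.exact_proj rfl) (g' := (0 : M →ₗ[Env k A] M))
      (fun y => ⟨fun hy => ⟨0, hy.symm⟩, fun ⟨_, hy⟩ => hy.symm⟩) h
    rw [TensorE.map_zero_right, add_zero] at hab
    exact ⟨a, hab.symm⟩

/-- The isomorphism from the stable tensor product to Tate-Hochschild homology. -/
def stableTensorEquiv (j : ℤ) :
    stableTensor (k := k) (A := A) (T.syzygy j) M ≃ₗ[k] TateHomology T M j :=
  ((Submodule.quotEquivOfEq _ _ (boundaries_eq_ker T M hA j)).trans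
    ((cyclesToStable T M hA j).quotKerEquivOfSurjective
      (cyclesToStable_surjective T M hA j))).symm

theorem coe_stableTensorEquiv_symm (j : ℤ) (z : cycles T M j) :
    ((stableTensorEquiv T M hA j).symm (Submodule.Quotient.mk z)).1
      = TensorE.map (T.proj j) LinearMap.id z.1 := rfl

variable {T M} in
theorem stableTensorEquiv_eq {j : ℤ} {w : stableTensor (k := k) (A := A) (T.syzygy j) M}
    {z : TensorE k A (T.complex.X j) M} (h : w.1 = TensorE.map (T.proj j) LinearMap.id z) :
    ∃ hz : z ∈ cycles T M j, stableTensorEquiv T M hA j w = Submodule.Quotient.mk ⟨z, hz⟩ := by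
  have hz : z ∈ cycles T M j := (mem_cycles_iff T hA).2 (h ▸ w.2)
  refine ⟨hz, ?_⟩
  rw [← LinearEquiv.eq_symm_apply]
  exact Subtype.ext h

variable {T M} (Δ : DiagonalApproximation T)

theorem cap_mk (i j : ℤ) (u : cocycles T i) (z : cycles T M j) {w : cycles T M (j - i)}
    (hw : w.1 = TensorE.map (rightLift Δ u.1 j (j - i)) LinearMap.id z.1) :
    cap Δ M i j (Submodule.Quotient.mk u) (Submodule.Quotient.mk z) = Submodule.Quotient.mk w := by
  refine (SubQ.bilin_mk _ _ _ _ u z).trans (congrArg Submodule.Quotient.mk (Subtype.ext ?_))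
  rw [hw, rightLift_eq u.1 (sub_add_cancel j i), TensorE.map_sgn_left, ← capMap_eq, mul_comm]
  rfl

variable (M) in
/-- The cap product on stable Hochschild homology. -/
def stableCap (i j : ℤ) : StableHom (k := k) (A := A) (T.syzygy i) A →ₗ[k]
    stableTensor (k := k) (A := A) (T.syzygy j) M →ₗ[k]
    stableTensor (k := k) (A := A) (T.syzygy (j - i)) M :=
  ((cap Δ M i j).compl₁₂ (stableHomEquiv T i).toLinearMap
    (stableTensorEquiv T M hA j).toLinearMap).compr₂
      (stableTensorEquiv T M hA (j - i)).symm.toLinearMap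

theorem stableTensorEquiv_stableCap (i j : ℤ) (f z) :
    stableTensorEquiv T M hA (j - i) (stableCap M hA Δ i j f z)
      = cap Δ M i j (stableHomEquiv T i f) (stableTensorEquiv T M hA j z) :=
  (stableTensorEquiv T M hA (j - i)).apply_symm_apply _

end StableHomology

/-! ## Dimension shifting and the cap product -/

/-- A relation between consecutive terms of a family indexed by the integers, total in both
directions, has a global section through any given element. -/
theorem exists_section {W : ℤ → Type*} {R : ∀ q, W q → W (q + 1) → Prop}
    (hf : ∀ q w, ∃ w', R q w w') (hb : ∀ q w', ∃ w, R q w w') (w₀ : W 0) :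
    ∃ s : ∀ q, W q, s 0 = w₀ ∧ ∀ q, R q (s q) (s (q + 1)) := by
  choose nxt hn using hf
  choose prv hp using hb
  refine ⟨fun q => Int.rec (motive := W)
    -- Nonnegative indices are reached from `w₀` by forward choices; `Int.negSucc 0 = -1` is the
    -- first backward choice from `w₀`.
    (fun n => Nat.rec (motive := fun n => W (Int.ofNat n)) w₀ (fun n w => nxt (Int.ofNat n) w) n)
    (fun n => Nat.rec (motive := fun n => W (Int.negSucc n)) (prv (Int.negSucc 0) w₀)
      (fun n w => prv (Int.negSucc (n + 1)) w) n) q, rfl, ?_⟩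
  rintro (n | n)
  · exact hn _ _
  · cases n with
    | zero => exact hp _ _
    | succ n => exact hp _ _

section Shift

variable {L M : Type u} [AddCommGroup L] [Module (Env k A) L]
  [AddCommGroup M] [Module (Env k A) M]
  (T : CompleteResolution k A L) (S : CompleteResolution k A M)

/-- The compatibility required of the elements that link the two sides of a dimension shift. -/
def IsLinked (i j : ℤ) (t : ∀ p q : ℤ, TensorE k A (T.complex.X p) (S.complex.X q)) : Prop :=
  ∀ p q : ℤ, p + q + 1 = j →
    sgn i • TensorE.map (dd T.complex (p + 1) p) LinearMap.id (t (p + 1) q)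
      = TensorE.map LinearMap.id (dd S.complex (q + 1) q) (t p (q + 1))

variable {T S}

theorem IsLinked.eq {i j : ℤ} {t : ∀ p q : ℤ, TensorE k A (T.complex.X p) (S.complex.X q)}
    (ht : IsLinked T S i j t) {p p' q q' : ℤ} (hp : p + 1 = p') (hq : q + 1 = q')
    (h : p' + q = j) :
    sgn i • TensorE.map (dd T.complex p' p) LinearMap.id (t p' q)
      = TensorE.map LinearMap.id (dd S.complex q' q) (t p q') := by
  subst hp hq
  exact ht p q (by omega)

theorem IsLinked.eq' {i j : ℤ} {t : ∀ p q : ℤ, TensorE k A (T.complex.X p) (S.complex.X q)}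
    (ht : IsLinked T S i j t) {p p' q q' : ℤ} (hp : p + 1 = p') (hq : q + 1 = q')
    (h : p' + q = j) :
    TensorE.map (dd T.complex p' p) LinearMap.id (t p' q)
      = sgn i • TensorE.map LinearMap.id (dd S.complex q' q) (t p q') := by
  rw [← ht.eq hp hq h, sgn_smul_sgn_smul]

section MapLemmas

variable {X Y X' Y' X'' Y'' : Type u}
  [AddCommGroup X] [Module k X] [Module (Env k A) X] [IsScalarTower k (Env k A) X]
  [AddCommGroup Y] [Module k Y] [Module (Env k A) Y] [IsScalarTower k (Env k A) Y]
  [AddCommGroup X'] [Module k X'] [Module (Env k A) X'] [IsScalarTower k (Env k A) X']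
  [AddCommGroup Y'] [Module k Y'] [Module (Env k A) Y'] [IsScalarTower k (Env k A) Y']
  [AddCommGroup X''] [Module k X''] [Module (Env k A) X''] [IsScalarTower k (Env k A) X'']
  [AddCommGroup Y''] [Module k Y''] [Module (Env k A) Y''] [IsScalarTower k (Env k A) Y'']

theorem TensorE.map_id_map (f : X →ₗ[Env k A] X') (g : Y →ₗ[Env k A] Y')
    (t : TensorE k A X Y) :
    TensorE.map LinearMap.id g (TensorE.map f LinearMap.id t) = TensorE.map f g t :=
  TensorE.map_map _ _ _ _ t

theorem TensorE.map_map_id (f : X →ₗ[Env k A] X') (g : Y →ₗ[Env k A] Y')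
    (t : TensorE k A X Y) :
    TensorE.map f LinearMap.id (TensorE.map LinearMap.id g t) = TensorE.map f g t :=
  TensorE.map_map _ _ _ _ t

theorem TensorE.map_map_eq_zero (f : X →ₗ[Env k A] X') (f' : X' →ₗ[Env k A] X'')
    (h : f' ∘ₗ f = 0) (g : Y →ₗ[Env k A] Y') (g' : Y' →ₗ[Env k A] Y'') (t : TensorE k A X Y) :
    TensorE.map f' g' (TensorE.map f g t) = 0 := by
  rw [TensorE.map_map, h, TensorE.map_zero_left]

theorem TensorE.map_map_eq_zero' (f : X →ₗ[Env k A] X') (f' : X' →ₗ[Env k A] X'')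
    (g : Y →ₗ[Env k A] Y') (g' : Y' →ₗ[Env k A] Y'') (h : g' ∘ₗ g = 0) (t : TensorE k A X Y) :
    TensorE.map f' g' (TensorE.map f g t) = 0 := by
  rw [TensorE.map_map, h, TensorE.map_zero_right]

end MapLemmas

theorem dd_comp_dd (C : Cx k A) (i j l : ℤ) : dd C j l ∘ₗ dd C i j = 0 :=
  LinearMap.ext fun x => dd_dd C i j l x

theorem CompleteResolution.proj_comp_dd {n i : ℤ} (h : i + 1 = n) :
    T.proj i ∘ₗ dd T.complex n i = 0 :=
  LinearMap.ext fun x => (T.exact_proj h _).2 ⟨x, rfl⟩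

theorem CompleteResolution.aug_comp_dd : T.aug ∘ₗ dd T.complex 1 0 = 0 :=
  LinearMap.ext fun x => (T.aug_exact _).2 ⟨x, rfl⟩

variable (T S) in
/-- An element on which the tensor product of the differentials vanishes belongs to a linked
family. -/
theorem exists_isLinked (i : ℤ) {j : ℤ} (t₀ : TensorE k A (T.complex.X j) (S.complex.X 0))
    (h₀ : TensorE.map (dd T.complex j (j - 1)) (dd S.complex 0 (0 - 1)) t₀ = 0) :
    ∃ t, IsLinked T S i j t ∧ t j 0 = t₀ := by
  -- The function `P q = j - q` is kept opaque so that `j` can be replaced by `P 0`, and the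
  -- starting element has its required type without a cast.
  obtain ⟨P, hP, hPj⟩ : ∃ P : ℤ → ℤ, P 0 = j ∧ ∀ q, P q + q = j :=
    ⟨fun q => j - q, sub_zero j, fun q => sub_add_cancel j q⟩
  subst hP
  -- The condition `(d ⊗ d) t = 0` is the obstruction to continuing the zigzag in either direction.
  -- Flatness of the terms of `T` and `S` solves each step, and `d d = 0` gives the condition again
  -- for the new element.
  let W (q : ℤ) : Type u := {t : TensorE k A (T.complex.X (P q)) (S.complex.X q) //
    ∀ p' q', p' + 1 = P q → q' + 1 = q →
      TensorE.map (dd T.complex (P q) p') (dd S.complex q q') t = 0}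
  let R (q : ℤ) (t : W q) (t' : W (q + 1)) : Prop :=
    sgn i • TensorE.map (dd T.complex (P q) (P (q + 1))) LinearMap.id t.1
      = TensorE.map LinearMap.id (dd S.complex (q + 1) q) t'.1
  have hPs (q : ℤ) : P (q + 1) + 1 = P q := by
    have := hPj q
    have := hPj (q + 1)
    omega
  have hf (q : ℤ) (w : W q) : ∃ w', R q w w' := by
    obtain ⟨t', ht'⟩ := TensorE.exists_map_id_eq (X := T.complex.X (P (q + 1)))
      (S.exact_of (rfl : q + 1 = q + 1) (sub_add_cancel q 1))
      (t := sgn i • TensorE.map (dd T.complex (P q) (P (q + 1))) LinearMap.id w.1) (by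
        rw [map_zsmul, TensorE.map_id_map, w.2 _ _ (hPs q) (sub_add_cancel q 1), smul_zero])
    refine ⟨⟨t', fun p' q' hp hq => ?_⟩, ht'.symm⟩
    obtain rfl : q' = q := by omega
    rw [← TensorE.map_map_id, ht', map_zsmul,
      TensorE.map_map_eq_zero _ _ (dd_comp_dd _ _ _ _), smul_zero]
  have hb (q : ℤ) (w' : W (q + 1)) : ∃ w, R q w w' := by
    obtain ⟨t, ht⟩ := TensorE.exists_map_id_eq' (X := S.complex.X q)
      (T.exact_of (hPs q) (sub_add_cancel (P (q + 1)) 1))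
      (t := sgn i • TensorE.map LinearMap.id (dd S.complex (q + 1) q) w'.1) (by
        rw [map_zsmul, TensorE.map_map_id, w'.2 _ _ (sub_add_cancel _ 1) rfl, smul_zero])
    refine ⟨⟨t, fun p' q' hp hq => ?_⟩, ?_⟩
    · obtain rfl : p' = P (q + 1) := by have := hPs q; omega
      rw [← TensorE.map_id_map, ht, map_zsmul,
        TensorE.map_map_eq_zero' _ _ _ _ (dd_comp_dd _ _ _ _), smul_zero]
    · change sgn i • TensorE.map _ LinearMap.id t = _
      rw [ht, sgn_smul_sgn_smul]
  obtain ⟨s, hs0, hs⟩ := exists_section hf hb ⟨t₀, fun p' q' hp hq => by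
    obtain rfl : p' = P 0 - 1 := by omega
    obtain rfl : q' = 0 - 1 := by omega
    exact h₀⟩
  refine ⟨fun p q => if h : P q = p then h ▸ (s q).1 else 0, fun p q hpq => ?_, ?_⟩
  · have key (p p' : ℤ) (hp : P (q + 1) = p) (hp' : P q = p') :
        sgn i • TensorE.map (dd T.complex p' p) LinearMap.id
            (if h : P q = p' then h ▸ (s q).1 else 0)
          = TensorE.map LinearMap.id (dd S.complex (q + 1) q)
            (if h : P (q + 1) = p then h ▸ (s (q + 1)).1 else 0) := by
      subst hp hp'
      simpa using hs q
    have := hPj q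
    have := hPs q
    exact key p (p + 1) (by omega) (by omega)
  · simp [hs0]

/-- In a linked family, being a sum of boundaries in the two directions propagates. -/
theorem IsLinked.exists_eq_add [Module k L] [IsScalarTower k (Env k A) L] {i j : ℤ}
    {t : ∀ p q : ℤ, TensorE k A (T.complex.X p) (S.complex.X q)} (ht : IsLinked T S i j t)
    (h₀ : TensorE.map T.aug (S.proj j) (t 0 j) = 0) (p : ℤ) :
    ∀ q p' q', p + q = j → p + 1 = p' → q + 1 = q' →
      ∃ (a : TensorE k A (T.complex.X p') (S.complex.X q))
        (b : TensorE k A (T.complex.X p) (S.complex.X q')),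
        t p q = TensorE.map (dd T.complex p' p) LinearMap.id a
          + TensorE.map LinearMap.id (dd S.complex q' q) b := by
  induction p using int_induction with
  | h0 =>
    rintro q p' q' h rfl hq'
    obtain rfl : q = j := by omega
    exact TensorE.exists_of_map_eq_zero T.aug_surjective (S.proj_surjective q) T.aug_exact
      (S.exact_proj hq') h₀
  | hup p ih =>
    rintro q p' q' h hp' rfl
    obtain ⟨a, b, hab⟩ := ih (q + 1) p (q + 1 + 1) (by omega) (by omega) rfl
    -- Subtracting `± (1 ⊗ d) a` from `t p q` leaves an element killed by `d ⊗ 1`, by linkedness;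
    -- flatness makes it a boundary in the first direction. The downward step is the mirror image,
    -- with `b`.
    obtain ⟨c, hc⟩ := TensorE.exists_map_id_eq' (X := S.complex.X q)
      (T.exact_of hp' (sub_add_cancel p 1))
      (t := t p q - sgn i • TensorE.map LinearMap.id (dd S.complex (q + 1) q) a) (by
        rw [map_sub, map_zsmul, TensorE.map_map_id,
          ht.eq' (sub_add_cancel p 1) (rfl : q + 1 = q + 1) h, hab, map_add,
          TensorE.map_map_eq_zero' _ _ _ _ (dd_comp_dd _ _ _ _), TensorE.map_id_map, add_zero,
          sub_self])
    exact ⟨c, sgn i • a, by rw [hc, map_zsmul, sub_add_cancel]⟩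
  | hdown p ih =>
    rintro q' p' q'' h hp' hq''
    obtain rfl : p' = p := by omega
    obtain ⟨q, rfl⟩ : ∃ q, q' = q + 1 := ⟨q' - 1, by omega⟩
    obtain ⟨a, b, hab⟩ := ih q (p' + 1) (q + 1) (by omega) rfl rfl
    obtain ⟨c, hc⟩ := TensorE.exists_map_id_eq (X := T.complex.X (p' - 1))
      (S.exact_of hq'' rfl)
      (t := t (p' - 1) (q + 1)
        - sgn i • TensorE.map (dd T.complex p' (p' - 1)) LinearMap.id b) (by
        rw [map_sub, map_zsmul, TensorE.map_id_map,
          ← ht.eq (sub_add_cancel p' 1) rfl (by omega), hab, map_add,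
          TensorE.map_map_eq_zero _ _ (dd_comp_dd _ _ _ _), TensorE.map_map_id, zero_add,
          sub_self])
    exact ⟨sgn i • b, c, by rw [hc, map_zsmul, add_sub_cancel]⟩

theorem IsLinked.sub {i j : ℤ} {t t' : ∀ p q : ℤ, TensorE k A (T.complex.X p) (S.complex.X q)}
    (ht : IsLinked T S i j t) (ht' : IsLinked T S i j t') :
    IsLinked T S i j fun p q => t p q - t' p q := fun p q h => by
  rw [map_sub, map_sub, smul_sub, ht p q h, ht' p q h]

end Shift

/-! ### Comparison of the cap products -/

section Cap

variable {T : CompleteResolution k A A} {M : Type u} [AddCommGroup M] [Module k M]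
  [Module (Env k A) M] [IsScalarTower k (Env k A) M] {S : CompleteResolution k A M}

/-- The differentials vanish on an element that lies over a cycle. -/
theorem map_dd_dd_eq_zero {j : ℤ} {t : TensorE k A (T.complex.X j) (S.complex.X 0)}
    (ht : TensorE.map LinearMap.id S.aug t ∈ cycles T M j) :
    TensorE.map (dd T.complex j (j - 1)) (dd S.complex 0 (0 - 1)) t = 0 := by
  -- The differential out of `S_0` factors through `ε`, so `(d ⊗ d) t` is an image of the boundary
  -- of `(1 ⊗ ε) t`.
  obtain ⟨f, hf⟩ := exists_factor S.aug_surjective (φ := dd S.complex 0 (0 - 1)) fun x hx => by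
    obtain ⟨y, rfl⟩ := (S.aug_exact x).1 hx
    exact dd_dd _ _ _ _ y
  have h : TensorE.map (dd T.complex j (j - 1)) LinearMap.id
      (TensorE.map LinearMap.id S.aug t) = 0 := ht
  rw [TensorE.map_map_id] at h
  rw [hf, ← LinearMap.id_comp (dd T.complex j (j - 1)), ← TensorE.map_map, h, map_zero]

/-- The sign `(-1)^i` of the shifted resolution cancels the one in the chain map condition, so a
zigzag for `Σ^{-i} T` becomes a zigzag for `T`. -/
theorem IsLinked.map {i j n : ℤ} {t : ∀ p q : ℤ, TensorE k A (T.complex.X p) (S.complex.X q)}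
    (ht : IsLinked T S i j t) {G : ∀ p q : ℤ, T.complex.X p →ₗ[Env k A] T.complex.X q}
    (hG : IsDegMap T i G) (hn : n + i = j) :
    IsLinked T S 0 n fun p q => TensorE.map (G (p + i) p) LinearMap.id (t (p + i) q) := by
  intro p q h
  have h1 : dd T.complex (p + 1) p ∘ₗ G (p + 1 + i) (p + 1)
      = sgn i • (G (p + i) p ∘ₗ dd T.complex (p + 1 + i) (p + i)) :=
    LinearMap.ext fun x => hG.apply' rfl (by omega) rfl x
  rw [sgn_zero, one_smul, TensorE.map_map, h1, TensorE.map_sgn_left, LinearMap.comp_id,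
    ← LinearMap.comp_id LinearMap.id, ← TensorE.map_map, ← map_zsmul,
    ht.eq (p := p + i) (p' := p + 1 + i) (by omega) (rfl : q + 1 = q + 1) (by omega),
    TensorE.map_map_id, TensorE.map_id_map]

theorem IsDegMap.map_mem_cycles {i j n : ℤ}
    {G : ∀ p q : ℤ, T.complex.X p →ₗ[Env k A] T.complex.X q} (hG : IsDegMap T i G)
    (hn : n + i = j) {z : TensorE k A (T.complex.X j) M} (hz : z ∈ cycles T M j) :
    TensorE.map (G j n) LinearMap.id z ∈ cycles T M n := by
  have h : TensorE.map (dd T.complex j (j - 1)) (LinearMap.id : M →ₗ[Env k A] M) z = 0 := hz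
  change TensorE.map (dd T.complex n (n - 1)) LinearMap.id _ = 0
  rw [TensorE.map_map, hG j n hn, TensorE.map_sgn_left, ← TensorE.map_map, h, map_zero, smul_zero]

/-- This is the uniqueness half of dimension shifting: `t j 0` is a sum of boundaries in the two
directions, and `ε` kills those coming from `S`. -/
theorem IsLinked.aug_mem_boundaries {i j : ℤ}
    {t : ∀ p q : ℤ, TensorE k A (T.complex.X p) (S.complex.X q)} (ht : IsLinked T S i j t)
    (h₀ : TensorE.map T.aug (S.proj j) (t 0 j) = 0) :
    TensorE.map LinearMap.id S.aug (t j 0) ∈ boundaries T M j := by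
  obtain ⟨a, b, hab⟩ := ht.exists_eq_add h₀ j 0 (j + 1) 1 (add_zero j) rfl rfl
  refine ⟨TensorE.map LinearMap.id S.aug a, ?_⟩
  rw [hab, map_add, TensorE.map_map_eq_zero' _ _ _ _ S.aug_comp_dd, add_zero, TensorE.map_id_map,
    homologyD, TensorE.map_map_id]

/-- The other end of a linked family depends only on the cohomology class of the map applied. -/
theorem IsLinked.map_eq_map {i j n : ℤ}
    {t : ∀ p q : ℤ, TensorE k A (T.complex.X p) (S.complex.X q)} (ht : IsLinked T S i j t)
    (h : i + n = j) {u v : T.complex.X i →ₗ[Env k A] A} (huv : u - v ∈ coboundaries T i) :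
    TensorE.map u (S.proj n) (t i n) = TensorE.map v (S.proj n) (t i n) := by
  obtain ⟨s, hs⟩ := huv
  rw [← sub_eq_zero, ← TensorE.map_sub_left, ← hs]
  change TensorE.map (s ∘ₗ dd T.complex i (i - 1)) _ _ = 0
  -- On a linked family `d ⊗ 1` may be traded for `1 ⊗ d`, which `π_n` annihilates.
  rw [← LinearMap.comp_id (S.proj n), ← TensorE.map_map, ht.eq' (sub_add_cancel i 1) rfl h,
    map_zsmul, TensorE.map_map_eq_zero' _ _ _ _ (S.proj_comp_dd rfl), smul_zero]

variable [Module.Finite k A] [Module.Finite (Env k A) M] (hA : IsFrobenius k A)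
  (Δ : DiagonalApproximation T)

theorem stableCap_mk {i j : ℤ} (f : T.syzygy i →ₗ[Env k A] A)
    {z : stableTensor (k := k) (A := A) (T.syzygy j) M} {ζ : TensorE k A (T.complex.X j) M}
    (hz : z.1 = TensorE.map (T.proj j) LinearMap.id ζ) :
    (stableCap M hA Δ i j (Submodule.Quotient.mk f) z).1 = TensorE.map (T.proj (j - i))
      LinearMap.id (TensorE.map (rightLift Δ (f ∘ₗ T.proj i) j (j - i)) LinearMap.id ζ) := by
  obtain ⟨hζ, hΨ⟩ := stableTensorEquiv_eq hA hz
  have hG := isDegMap_rightLift (Δ := Δ) (comp_proj_mem_cocycles T f)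
  have h : stableCap M hA Δ i j (Submodule.Quotient.mk f) z
      = (stableTensorEquiv T M hA (j - i)).symm (Submodule.Quotient.mk
        ⟨_, hG.map_mem_cycles (sub_add_cancel j i) hζ⟩) := by
    rw [LinearEquiv.eq_symm_apply, stableTensorEquiv_stableCap, hΨ, stableHomEquiv_mk]
    exact cap_mk Δ i j _ _ rfl
  rw [h, coe_stableTensorEquiv_symm]

theorem map_proj_eq_zero_of_mem_boundaries {j : ℤ} {z : TensorE k A (T.complex.X j) M}
    (hz : z ∈ boundaries T M j) :
    TensorE.map (T.proj j) (LinearMap.id : M →ₗ[Env k A] M) z = 0 := by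
  obtain ⟨c, rfl⟩ := hz
  exact TensorE.map_map_eq_zero _ _ (T.proj_comp_dd rfl) _ _ c

/-- The given `t'` and the image of `t` under the lift of `f₀` have the same end in `A ⊗ Ω^{j-i} M`.
Their other ends therefore differ by a boundary, which disappears under `π_{j-i}`. -/
theorem IsStableCap.eq_stableCap {i j : ℤ} {f z z'} (h : IsStableCap T S i j f z z') :
    z' = stableCap M hA Δ i j f z := by
  obtain ⟨f₀, y, rfl, ⟨t, ht, hz, hy⟩, ⟨t', ht', hz', hy'⟩⟩ := h
  replace ht : IsLinked T S i j t := ht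
  replace ht' : IsLinked T S 0 (j - i) t' := ht'
  have hu := comp_proj_mem_cocycles T f₀
  rw [← TensorE.map_map_id] at hz hz'
  have hlink := ht'.sub (ht.map (isDegMap_rightLift (Δ := Δ) hu) (sub_add_cancel j i))
  -- `ε ∘ rightLift (f₀ π_i)` agrees with `f₀ π_i` only up to a coboundary, which the end of a
  -- linked family does not see. The index `m` stands for `0 + i`.
  have h₀ (m : ℤ) (hm : m = i) : TensorE.map T.aug (S.proj (j - i))
      (TensorE.map (rightLift Δ (f₀ ∘ₗ T.proj i) m 0) LinearMap.id (t m (j - i)))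
      = TensorE.map f₀ LinearMap.id y.1 := by
    subst hm
    rw [hy, TensorE.map_map, TensorE.map_map, LinearMap.comp_id, LinearMap.id_comp]
    exact ht.map_eq_map (add_sub_cancel m j) (aug_comp_rightLift Δ hu)
  have hbd := hlink.aug_mem_boundaries (by rw [map_sub, h₀ _ (zero_add i), ← hy', sub_self])
  have h₁ (m : ℤ) (hm : m = j) : TensorE.map LinearMap.id S.aug
      (TensorE.map (rightLift Δ (f₀ ∘ₗ T.proj i) m (j - i)) LinearMap.id (t m 0))
      = TensorE.map (rightLift Δ (f₀ ∘ₗ T.proj i) j (j - i)) LinearMap.id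
        (TensorE.map LinearMap.id S.aug (t j 0)) := by
    subst hm
    rw [TensorE.map_id_map, TensorE.map_map_id]
  have := map_proj_eq_zero_of_mem_boundaries hbd
  rw [map_sub, map_sub, sub_eq_zero, h₁ _ (sub_add_cancel j i), ← hz'] at this
  exact Subtype.ext (this.trans (stableCap_mk hA Δ f₀ hz).symm)

/-- A cycle over `z` lifts to `T_j ⊗ S_0` and extends to a linked family; its image under the lift
of `f` is the second zigzag. The representative `f₀` is chosen so that the end over `A ⊗ Ω^{j-i} M`
matches exactly. -/
theorem isStableCap_stableCap (i j : ℤ) (f z) :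
    IsStableCap T S i j f z (stableCap M hA Δ i j f z) := by
  obtain ⟨f, rfl⟩ := Submodule.Quotient.mk_surjective _ f
  obtain ⟨f₀, hf₀, haug⟩ := exists_rep_rightLift Δ f
  have hG := isDegMap_rightLift (Δ := Δ) (comp_proj_mem_cocycles T f)
  obtain ⟨⟨ζ, hζ⟩, hz⟩ := cyclesToStable_surjective T M hA j z
  replace hz : z.1 = TensorE.map (T.proj j) LinearMap.id ζ := congrArg Subtype.val hz.symm
  obtain ⟨t₀, rfl⟩ := TensorE.map_surjective
    (show Function.Surjective (LinearMap.id : T.complex.X j →ₗ[Env k A] T.complex.X j) from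
      Function.surjective_id) S.aug_surjective ζ
  obtain ⟨t, ht, rfl⟩ := exists_isLinked T S i t₀ (map_dd_dd_eq_zero hζ)
  refine ⟨f₀, ⟨TensorE.map (T.proj i) (S.proj (j - i)) (t i (j - i)), ?_⟩, hf₀,
    ⟨t, ht, by rw [hz, TensorE.map_map_id], rfl⟩, ⟨fun p q => TensorE.map
      (rightLift Δ (f ∘ₗ T.proj i) (p + i) p) LinearMap.id (t (p + i) q),
      ht.map hG (sub_add_cancel j i), ?_, ?_⟩⟩
  -- The end `y` is stable: its image in `T_{i-1} ⊗ Ω^{j-i} M` is, by linkedness, the image under `1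
  -- ⊗ π d = 0` of the next element of the zigzag.
  · rw [mem_stableTensor_iff hA, TensorE.map_map, T.subtype_comp_proj, LinearMap.id_comp,
      ← TensorE.map_id_map, ht.eq' (sub_add_cancel i 1) rfl (add_sub_cancel i j), map_zsmul,
      TensorE.map_map_eq_zero' _ _ _ _ (S.proj_comp_dd rfl), smul_zero]
  · rw [stableCap_mk hA Δ f hz]
    have h₁ (m : ℤ) (hm : m = j) : TensorE.map (T.proj (j - i)) LinearMap.id
        (TensorE.map (rightLift Δ (f ∘ₗ T.proj i) j (j - i)) LinearMap.id
          (TensorE.map LinearMap.id S.aug (t j 0)))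
        = TensorE.map (T.proj (j - i)) S.aug
          (TensorE.map (rightLift Δ (f ∘ₗ T.proj i) m (j - i)) LinearMap.id (t m 0)) := by
      subst hm
      rw [TensorE.map_map_id, TensorE.map_map, TensorE.map_map]
      rfl
    exact h₁ _ (sub_add_cancel j i)
  · have h₀ (m : ℤ) (hm : m = i) : TensorE.map f₀ LinearMap.id
        (TensorE.map (T.proj i) (S.proj (j - i)) (t i (j - i)))
        = TensorE.map T.aug (S.proj (j - i))
          (TensorE.map (rightLift Δ (f ∘ₗ T.proj i) m 0) LinearMap.id (t m (j - i))) := by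
      subst hm
      rw [TensorE.map_map, TensorE.map_map, haug]
      rfl
    exact h₀ _ (zero_add i)

theorem isStableCap_iff (i j : ℤ) (f z z') :
    IsStableCap T S i j f z z' ↔ z' = stableCap M hA Δ i j f z :=
  ⟨fun h => h.eq_stableCap hA Δ, fun h => h ▸ isStableCap_stableCap hA Δ i j f z⟩

end Cap

end

end TateHochschild

open TateHochschild

theorem lemma3p15 {k A : Type u} [Field k] [Ring A] [Algebra k A] [Module.Finite k A]
    (hA : IsFrobenius k A) (T : CompleteResolution k A A) (Δ : DiagonalApproximation T) :
    ∃ (Φ : ∀ i : ℤ, StableHom (k := k) (A := A) (T.syzygy i) A ≃ₗ[k] TateCohomology T i)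
      (cupES : ∀ i j : ℤ, StableHom (k := k) (A := A) (T.syzygy i) A →ₗ[k]
        StableHom (k := k) (A := A) (T.syzygy j) A →ₗ[k]
        StableHom (k := k) (A := A) (T.syzygy (i + j)) A)
      (oneES : StableHom (k := k) (A := A) (T.syzygy 0) A),
      -- `Φ i` is the map `[f] ↦ [f ∘ π_i]`
      (∀ (i : ℤ) (f : T.syzygy i →ₗ[Env k A] A), ∃ hf : f ∘ₗ T.proj i ∈ cocycles T i,
        Φ i (Submodule.Quotient.mk f) = Submodule.Quotient.mk ⟨f ∘ₗ T.proj i, hf⟩) ∧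
      -- `cupES` is the product `f ∪ g = f ∘ Ω^i g`
      (∀ (i j : ℤ) f g h, IsStableCup T i j f g h ↔ h = cupES i j f g) ∧
      -- both sides are graded commutative algebras, and `Φ` is an isomorphism of algebras
      IsGradedCommAlgebra cupES oneES ∧
      IsGradedCommAlgebra (k := k) (H := fun i => TateCohomology T i) (cup Δ) (tateOne T) ∧
      (∀ (i j : ℤ) f g, Φ (i + j) (cupES i j f g) = cup Δ i j (Φ i f) (Φ j g)) ∧
      Φ 0 oneES = tateOne T ∧
      -- for every finitely generated bimodule `M`, the cap products correspond
      ∀ (M : Type u) [AddCommGroup M] [Module k M] [Module (Env k A) M]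
        [IsScalarTower k (Env k A) M] [Module.Finite (Env k A) M],
        ∃ (Ψ : ∀ j : ℤ, stableTensor (k := k) (A := A) (T.syzygy j) M ≃ₗ[k] TateHomology T M j)
          (capES : ∀ i j : ℤ, StableHom (k := k) (A := A) (T.syzygy i) A →ₗ[k]
            stableTensor (k := k) (A := A) (T.syzygy j) M →ₗ[k]
            stableTensor (k := k) (A := A) (T.syzygy (j - i)) M),
          -- `Ψ j` is the map `w ↦ [z]`, where `(π_j ⊗ id) z = w`
          (∀ (j : ℤ) (z : cycles T M j),
            ((Ψ j).symm (Submodule.Quotient.mk z)).1 = TensorE.map (T.proj j) LinearMap.id z.1) ∧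
          -- `capES` is the product `∩`, computed with any complete resolution of `M`
          (∀ (S : CompleteResolution k A M) (i j : ℤ) f z z',
            IsStableCap T S i j f z z' ↔ z' = capES i j f z) ∧
          ∀ (i j : ℤ) f z, cap Δ M i j (Φ i f) (Ψ j z) = Ψ (j - i) (capES i j f z) := by
  refine ⟨stableHomEquiv T, stableCup Δ, (stableHomEquiv T 0).symm (tateOne T),
    fun i f => ⟨comp_proj_mem_cocycles T f, stableHomEquiv_mk T i f⟩, isStableCup_iff Δ,
    isGradedCommAlgebra_stableCup Δ, isGradedCommAlgebra_cup Δ, stableHomEquiv_stableCup Δ,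
    (stableHomEquiv T 0).apply_symm_apply _, fun M _ _ _ _ _ => ?_⟩
  exact ⟨stableTensorEquiv T M hA, stableCap M hA Δ, coe_stableTensorEquiv_symm T M hA,
    fun S => isStableCap_iff hA Δ, fun i j f z => (stableTensorEquiv_stableCap hA Δ i j f z).symm⟩
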